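/- Let $V$ be a real, reflexive, separable Banach space that is continuously and densely embedded in a real separable Hilbert space $H$, with dual pairing $\langle\cdot,\cdot\rangle$ between $V^*$ and $V$. Let $T\in(0,\infty)$, let $(\Omega,\mathcal F,(\mathcal F_t)_{t\in[0,T]},\mathbb P)$ be a filtered probability space satisfying the usual conditions, let $U$ be a separable Hilbert space, $Q$ a bounded, symmetric, non-negative operator on $U$, and let $U_0=Q^{1/2}(U)$ with inner product $(u,v)_{U_0}=(Q^{-1/2}u,Q^{-1/2}v)_U$ ($Q^{-1/2}$ the pseudo-inverse). Let $W$ be a (possibly cylindrical) $Q$-Wiener process with respect to $(\mathcal F_t)$, that is $W(t)=\sum_j\beta_j(t)e_j$ with an orthonormal basis $(e_j)$ of $U_0$ and independent scalar $(\mathcal F_t)$-Brownian motions $(\beta_j)$ whose increments after time $s$ are jointly independent of $\mathcal F_s$. $\mathcal L_2=\mathcal L_2(U_0,H)$ denotes the space of Hilbert–Schmidt operators; for an $\mathcal F_s$-measurable $\mathcal L_2$-valued $\Phi$ and $s\le t$, $\Phi\,(W(t)-W(s))$ is the limit in probability of $\sum_j(\beta_j(t)-\beta_j(s))\Phi e_j$.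 Let $p\in(1,\infty)$, and let $A\colon V\times\Omega\to V^*$ and $B\colon V\times\Omega\to\mathcal L_2$ be measurable with respect to $\mathcal B(V)\otimes\mathcal F_0$ and the Borel $\sigma$-algebras. Assume that $\lambda\mapsto\langle A(u+\lambda v,\omega),w\rangle$ is continuous on $[0,1]$ for all $u,v,w\in V$, $\omega\in\Omega$, and that there are $\kappa,c\in[0,\infty)$, $\mu\in(0,\infty)$, $\nu\in[1,\infty)$ such that on $\Omega$, for all $u,v\in V$, $$2\langle A(u)-A(v),u-v\rangle+\kappa\|u-v\|_H^2\ge\|B(u)-B(v)\|_{\mathcal L_2}^2,$$ $$2\langle A(v),v\rangle+\kappa\|v\|_H^2\ge\nu\|B(v)\|_{\mathcal L_2}^2+\mu\|v\|_V^p-c,\qquad \|A(v)\|_{V^*}\le c(1+\|v\|_V)^{p-1}.$$ Let $V_h\subset V$ be a finite-dimensional subspace, $N_k\in\{1,2,\dots\}$, $k=T/N_k$, $t_n=nk$, and assume $k\kappa\le3$. Let the initial values $X^0,X^1$ satisfy, for $n\in\{0,1\}$, $X^n\in L^2(\Omega,\mathcal F_{t_n},\mathbb P;H)$, $X^n\in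 V_h$ almost surely and $B(X^n)\in L^2(\Omega,\mathcal F_{t_n},\mathbb P;\mathcal L_2)$. Consider the BDF2-Maruyama scheme $$\Big(\tfrac32X^n-2X^{n-1}+\tfrac12X^{n-2},v\Big)_H+k\langle A(X^n),v\rangle=\Big(\tfrac32B(X^{n-1})\Delta_kW^n-\tfrac12B(X^{n-2})\Delta_kW^{n-1},v\Big)_H\quad\mathbb P\text{-a.s.}$$ for all $v\in V_h$ and $n=2,\dots,N_k$, where $\Delta_kW^n=W(t_n)-W(t_{n-1})$. Then: 1. The scheme has an $(\mathcal F_{t_n})_{n=0}^{N_k}$-adapted, $\mathbb P$-almost surely $V_h$-valued solution $(X^n)_{n=0}^{N_k}$ with the given initial values. 2. If $k\kappa<3$, this solution is unique: any two such solutions $(X^n)$, $(Y^n)$ are indistinguishable, i.e. $\mathbb P(X^n=Y^n\text{ for all }n\in\{0,\dots,N_k\})=1$. 3. If $2k\kappa<1$, then $X^n\in L^p(\Omega;V)\cap L^2(\Omega;H)$ for every $n\in\{2,\dots,N_k\}$. -/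

import Mathlib

open MeasureTheory ProbabilityTheory Filter Topology
open scoped ENNReal NNReal

noncomputable section

/-! ### The Hilbert space `U₀ = Q^{1/2}(U)` -/

section CameronMartin

variable {U : Type*} [NormedAddCommGroup U] [InnerProductSpace ℝ U] [CompleteSpace U]

/-- `R = Q^{1/2}`: the symmetric non-negative operator with `R ∘ R = Q`. -/
def IsOperatorSqrt (R Q : U →L[ℝ] U) : Prop := R.IsPositive ∧ R ∘L R = Q

/-- `U₀ = R(U)`, the range of `R = Q^{1/2}`; it carries the inner product
`(u, v)_{U₀} = (R⁻¹ u, R⁻¹ v)_U` with the pseudo-inverse `R⁻¹`, see below. -/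
def CameronMartin (R : U →L[ℝ] U) : Type _ := LinearMap.range (R : U →ₗ[ℝ] U)

namespace CameronMartin

variable (R : U →L[ℝ] U)

instance : AddCommGroup (CameronMartin R) :=
  inferInstanceAs (AddCommGroup (LinearMap.range (R : U →ₗ[ℝ] U)))

instance : Module ℝ (CameronMartin R) :=
  inferInstanceAs (Module ℝ (LinearMap.range (R : U →ₗ[ℝ] U)))

/-- The inclusion `U₀ ⊆ U`. -/
def incl : CameronMartin R →ₗ[ℝ] U := (LinearMap.range (R : U →ₗ[ℝ] U)).subtype

/-- The kernel of `R`. -/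
abbrev kernel : Submodule ℝ U := LinearMap.ker (R : U →ₗ[ℝ] U)

instance : CompleteSpace (kernel R) :=
  (ContinuousLinearMap.isClosed_ker R).completeSpace_coe

/-- `R` restricts to a linear bijection from `(ker R)ᗮ` onto `U₀`. -/
def equiv : (kernel R)ᗮ ≃ₗ[ℝ] CameronMartin R :=
  LinearMap.kerComplementEquivRange (R : U →ₗ[ℝ] U) (kernel R).isCompl_orthogonal.symm

/-- The pseudo-inverse `R⁻¹ : U₀ → (ker R)ᗮ ⊆ U`. -/
def pinv : CameronMartin R →ₗ[ℝ] U := (kernel R)ᗮ.subtype ∘ₗ (equiv R).symm.toLinearMap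

theorem pinv_injective : Function.Injective (pinv R) :=
  Subtype.val_injective.comp (equiv R).symm.injective

instance : NormedAddCommGroup (CameronMartin R) :=
  NormedAddCommGroup.induced (CameronMartin R) U (pinv R) (pinv_injective R)

instance : InnerProductSpace ℝ (CameronMartin R) where
  norm_smul_le a u := by
    change ‖pinv R (a • u)‖ ≤ ‖a‖ * ‖pinv R u‖
    rw [map_smul, norm_smul]
  inner u v := inner ℝ (pinv R u) (pinv R v)
  norm_sq_eq_re_inner u := by
    change ‖pinv R u‖ ^ 2 = _
    exact norm_sq_eq_re_inner (𝕜 := ℝ) (pinv R u)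
  conj_inner_symm u v := inner_conj_symm (𝕜 := ℝ) (pinv R u) (pinv R v)
  add_left u v w := by simp only [map_add, inner_add_left]
  smul_left u v a := by simp only [map_smul, inner_smul_left]

theorem inner_def (u v : CameronMartin R) :
    inner ℝ u v = inner ℝ (pinv R u) (pinv R v) := rfl

theorem incl_eq (u : CameronMartin R) : R (pinv R u) = incl R u := by
  obtain ⟨x, rfl⟩ := (equiv R).surjective u
  have h : pinv R (equiv R x) = x := by simp [pinv]
  rw [h]
  rfl

/-- `R : (ker R)ᗮ → U₀` is an isometry. -/
def isometryEquiv : (kernel R)ᗮ ≃ₗᵢ[ℝ] CameronMartin R where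
  toLinearEquiv := equiv R
  norm_map' x := by
    change ‖pinv R (equiv R x)‖ = ‖x‖
    simp [pinv]

instance : CompleteSpace (CameronMartin R) :=
  (isometryEquiv R).toIsometryEquiv.completeSpace_iff.mp inferInstance

end CameronMartin

end CameronMartin

/-! ### Hilbert-Schmidt operators -/

section HilbertSchmidt

variable (E : Type*) [NormedAddCommGroup E] [InnerProductSpace ℝ E] [CompleteSpace E]
  (H : Type*) [NormedAddCommGroup H] [InnerProductSpace ℝ H]

/-- The index set of a chosen orthonormal basis of `E`. -/
def onbIndex : Set E := (exists_hilbertBasis ℝ E).choose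

/-- A chosen orthonormal basis of `E`. -/
def onb : HilbertBasis (onbIndex E) ℝ E := (exists_hilbertBasis ℝ E).choose_spec.choose

/-- The Hilbert-Schmidt operators `ℒ₂(E, H)`: the bounded operators `b` such that
`Tr (b* b) = ∑ ‖b eᵢ‖²` is finite for an orthonormal basis `(eᵢ)` of `E` (as is well known,
the value of this sum does not depend on the basis). -/
def hilbertSchmidtSubmodule : Submodule ℝ (E →L[ℝ] H) where
  carrier := {b | Memℓp (fun i => b (onb E i)) 2}
  add_mem' {_ _} ha hb := Memℓp.add (E := fun _ : onbIndex E => H) ha hb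
  zero_mem' := zero_memℓp (E := fun _ : onbIndex E => H) (p := 2)
  smul_mem' r _ hb := Memℓp.const_smul (E := fun _ : onbIndex E => H) (𝕜 := ℝ) hb r

/-- The space `ℒ₂(E, H)`, with the Hilbert-Schmidt norm. -/
def HilbertSchmidt : Type _ := hilbertSchmidtSubmodule E H

namespace HilbertSchmidt

instance : AddCommGroup (HilbertSchmidt E H) :=
  inferInstanceAs (AddCommGroup (hilbertSchmidtSubmodule E H))

instance : Module ℝ (HilbertSchmidt E H) :=
  inferInstanceAs (Module ℝ (hilbertSchmidtSubmodule E H))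

/-- A Hilbert-Schmidt operator as a bounded operator. -/
def toCLM : HilbertSchmidt E H →ₗ[ℝ] (E →L[ℝ] H) := (hilbertSchmidtSubmodule E H).subtype

/-- The values of a Hilbert-Schmidt operator on the chosen basis, as an element of `ℓ²`. -/
def coords : HilbertSchmidt E H →ₗ[ℝ] lp (fun _ : onbIndex E => H) 2 where
  toFun b := ⟨fun i => toCLM E H b (onb E i), b.2⟩
  map_add' _ _ := by ext i; rfl
  map_smul' _ _ := by ext i; rfl

theorem coords_apply (b : HilbertSchmidt E H) (i : onbIndex E) :
    coords E H b i = toCLM E H b (onb E i) := rfl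

theorem coords_injective : Function.Injective (coords E H) := by
  intro a b hab
  apply Subtype.ext
  refine ContinuousLinearMap.ext_on (s := Set.range (onb E)) ?_ ?_
  · have := (onb E).dense_span
    rw [Submodule.dense_iff_topologicalClosure_eq_top]
    exact this
  · rintro _ ⟨i, rfl⟩
    have := congrArg (fun f : lp (fun _ : onbIndex E => H) 2 => f i) hab
    exact this

instance : NormedAddCommGroup (HilbertSchmidt E H) :=
  NormedAddCommGroup.induced (HilbertSchmidt E H) (lp (fun _ : onbIndex E => H) 2)
    (coords E H) (coords_injective E H)

/-- `‖b‖² = Tr (b* b) = ∑ ‖b eᵢ‖²`. -/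
theorem norm_sq_eq (b : HilbertSchmidt E H) :
    ‖b‖ ^ 2 = ∑' i, ‖toCLM E H b (onb E i)‖ ^ 2 := by
  have := lp.norm_rpow_eq_tsum (p := 2) (by norm_num) (coords E H b)
  simp only [ENNReal.toReal_ofNat, Real.rpow_ofNat] at this
  exact this

/-- The Borel `σ`-algebra of `ℒ₂(E, H)`. -/
instance : MeasurableSpace (HilbertSchmidt E H) := borel _

instance : BorelSpace (HilbertSchmidt E H) := ⟨rfl⟩

end HilbertSchmidt

end HilbertSchmidt

/-! ### Filtered probability space, Wiener process and its increments -/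

section Wiener

variable {Ω : Type*} {mΩ : MeasurableSpace Ω}

/-- The usual conditions: the filtration is right-continuous and `F₀` (hence every `F_t`)
contains all `P`-null sets. -/
structure UsualConditions (P : Measure Ω) {T : ℝ} (F : Filtration (Set.Icc (0 : ℝ) T) mΩ) :
    Prop where
  rightContinuous : F.IsRightContinuous
  complete : ∀ (t : Set.Icc (0 : ℝ) T) (s : Set Ω), P s = 0 → MeasurableSet[F t] s

/-- `(β_j)_j` is a family of independent scalar Brownian motions on `[0,T]` with respect to the
filtration `F`: adapted, started at `0`, with continuous paths, and such that for all `s ≤ t` the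
increments `β_j(t) - β_j(s)` are `N(0, t - s)`-distributed, independent of each other and jointly
independent of `F_s`.

With an orthonormal basis `(e_j)` of `U₀ = Q^{1/2}(U)` such a family is the (cylindrical)
`Q`-Wiener process with respect to `F`, `W(t) = ∑_j β_j(t) e_j`. If `Q` has finite trace, the
series converges in `U`, and `e_j = √q_j χ_j` for the eigenpairs with `q_j > 0` gives the
Karhunen-Loève expansion of an arbitrary `U`-valued `Q`-Wiener process. -/
structure IsBrownianFamily (P : Measure Ω) {T : ℝ} (F : Filtration (Set.Icc (0 : ℝ) T) mΩ)
    {J : Type*} (β : J → Set.Icc (0 : ℝ) T → Ω → ℝ) : Prop where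
  adapted : ∀ j t, Measurable[F t] (β j t)
  start : ∀ j, ∀ᵐ ω ∂P, ∀ t : Set.Icc (0 : ℝ) T, (t : ℝ) = 0 → β j t ω = 0
  continuous : ∀ j, ∀ᵐ ω ∂P, Continuous fun t => β j t ω
  law : ∀ j s t, s ≤ t →
    P.map (fun ω => β j t ω - β j s ω) = gaussianReal 0 ((t : ℝ) - s).toNNReal
  indep : ∀ s t, s ≤ t → iIndepFun (fun j ω => β j t ω - β j s ω) P
  indep_past : ∀ s t, s ≤ t →
    Indep (F s) (MeasurableSpace.comap (fun ω j => β j t ω - β j s ω) MeasurableSpace.pi) P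

variable {E : Type*} [NormedAddCommGroup E] [InnerProductSpace ℝ E] [CompleteSpace E]
  {H : Type*} [NormedAddCommGroup H] [InnerProductSpace ℝ H]

/-- `Z` is (a version of) the random variable `Φ (W(t) - W(s)) = ∫_s^t Φ dW`, where
`Φ : Ω → ℒ₂(E, H)` is a random operator and `W = ∑_j β_j e_j` for an orthonormal basis `e` of `E`:
the series `∑_j (β_j(t) - β_j(s)) Φ e_j` converges in probability to `Z`. -/
def IsNoiseIncrement (P : Measure Ω) {T : ℝ} {J : Type*} (e : HilbertBasis J ℝ E)
    (β : J → Set.Icc (0 : ℝ) T → Ω → ℝ) (Φ : Ω → HilbertSchmidt E H)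
    (s t : Set.Icc (0 : ℝ) T) (Z : Ω → H) : Prop :=
  TendstoInMeasure P
    (fun (S : Finset J) ω => ∑ j ∈ S, (β j t ω - β j s ω) • HilbertSchmidt.toCLM E H (Φ ω) (e j))
    atTop Z

end Wiener

/-! ### Gelfand triple, coefficients and the scheme -/

section Scheme

variable {V : Type*} [NormedAddCommGroup V] [NormedSpace ℝ V]
  {H : Type*} [NormedAddCommGroup H] [InnerProductSpace ℝ H]

/-- `V` is reflexive and `ι : V → H` is a continuous and dense embedding. -/
structure IsGelfandTriple (ι : V →L[ℝ] H) : Prop where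
  injective : Function.Injective ι
  dense : DenseRange ι
  reflexive : Function.Surjective (NormedSpace.inclusionInDoubleDual ℝ V)

/-- For `x ∈ ι(V)` the element of `V` that is identified with `x`; a fixed element of `V` for the
other `x ∈ H`. It is applied below to random variables with values almost surely in `ι(V)`. -/
def embPreimage (ι : V →L[ℝ] H) (x : H) : V := Function.invFun ι x

theorem embPreimage_apply {ι : V →L[ℝ] H} (h : Function.Injective ι) (v : V) :
    embPreimage ι (ι v) = v := Function.leftInverse_invFun h v

variable {Ω : Type*} {E : Type*} [NormedAddCommGroup E] [InnerProductSpace ℝ E] [CompleteSpace E]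

/-- Measurability, hemicontinuity, monotonicity, coercivity and growth of the coefficients
`A : V × Ω → V*` and `B : V × Ω → ℒ₂(E, H)`; `m₀` is the `σ`-algebra `F₀`. -/
structure CoefficientConditions [MeasurableSpace V] (ι : V →L[ℝ] H) (m₀ : MeasurableSpace Ω)
    (p κ c μ ν : ℝ) (A : V → Ω → StrongDual ℝ V) (B : V → Ω → HilbertSchmidt E H) : Prop where
  measurable_A : Measurable[(inferInstance : MeasurableSpace V).prod m₀]
    fun z : V × Ω => A z.1 z.2
  measurable_B : Measurable[(inferInstance : MeasurableSpace V).prod m₀]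
    fun z : V × Ω => B z.1 z.2
  hemicontinuous : ∀ (u v w : V) (ω : Ω),
    ContinuousOn (fun r : ℝ => A (u + r • v) ω w) (Set.Icc 0 1)
  κ_nonneg : 0 ≤ κ
  c_nonneg : 0 ≤ c
  μ_pos : 0 < μ
  one_le_ν : 1 ≤ ν
  monotone : ∀ (u v : V) (ω : Ω),
    ‖B u ω - B v ω‖ ^ 2 ≤ 2 * (A u ω - A v ω) (u - v) + κ * ‖ι (u - v)‖ ^ 2
  coercive : ∀ (v : V) (ω : Ω),
    ν * ‖B v ω‖ ^ 2 + μ * ‖v‖ ^ p - c ≤ 2 * A v ω v + κ * ‖ι v‖ ^ 2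
  growth : ∀ (v : V) (ω : Ω), ‖A v ω‖ ≤ c * (1 + ‖v‖) ^ (p - 1)

/-- The grid point `t_n = n T / N` for `n ≤ N` (and `t_n = T` for `n > N`, which is not used). -/
def gridPoint {T : ℝ} (hT : 0 < T) (N n : ℕ) : Set.Icc (0 : ℝ) T :=
  Set.projIcc 0 T hT.le (n * (T / N))

theorem gridPoint_coe {T : ℝ} (hT : 0 < T) {N n : ℕ} (hN : 0 < N) (hn : n ≤ N) :
    (gridPoint hT N n : ℝ) = n * (T / N) := by
  have hN' : (0 : ℝ) < N := by exact_mod_cast hN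
  have hn' : (n : ℝ) ≤ N := by exact_mod_cast hn
  have h1 : (n : ℝ) * (T / N) ≤ T := by
    rw [← mul_div_assoc, div_le_iff₀ hN', mul_comm]
    gcongr
  have h2 : 0 ≤ (n : ℝ) * (T / N) := by positivity
  rw [gridPoint, Set.projIcc_of_mem hT.le ⟨h2, h1⟩]

variable {mΩ : MeasurableSpace Ω}

/-- The admissible initial values `ξ 0 = X⁰`, `ξ 1 = X¹` with
`Xⁿ ∈ L²(Ω, F_{t_n}, P; H)`, `B(Xⁿ) ∈ L²(Ω, F_{t_n}, P; ℒ₂(E, H))` and `Xⁿ ∈ V_h` a.s. -/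
structure AdmissibleInitialValues [MeasurableSpace H] (P : Measure Ω) {T : ℝ} (hT : 0 < T)
    (F : Filtration (Set.Icc (0 : ℝ) T) mΩ) (ι : V →L[ℝ] H) (B : V → Ω → HilbertSchmidt E H)
    (Vh : Submodule ℝ V) (N : ℕ) (ξ : Fin 2 → Ω → H) : Prop where
  measurable : ∀ n : Fin 2, Measurable[F (gridPoint hT N n)] (ξ n)
  memLp : ∀ n, MemLp (ξ n) 2 P
  measurable_B : ∀ n : Fin 2, Measurable[F (gridPoint hT N n)] fun ω => B (embPreimage ι (ξ n ω)) ω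
  memLp_B : ∀ n, MemLp (fun ω => B (embPreimage ι (ξ n ω)) ω) 2 P
  mem : ∀ n, ∀ᵐ ω ∂P, ∃ x ∈ Vh, ι x = ξ n ω

/-- `(X n)_{n ≤ N}` is an adapted, almost surely `V_h`-valued solution of the BDF2-Maruyama scheme
with step size `k = T / N`, initial values `ξ` and the Wiener process `W = ∑_j β_j e_j`. -/
structure IsBDF2Solution [MeasurableSpace H] (P : Measure Ω) {T : ℝ} (hT : 0 < T)
    (F : Filtration (Set.Icc (0 : ℝ) T) mΩ) {J : Type*} (e : HilbertBasis J ℝ E)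
    (β : J → Set.Icc (0 : ℝ) T → Ω → ℝ) (ι : V →L[ℝ] H)
    (A : V → Ω → StrongDual ℝ V) (B : V → Ω → HilbertSchmidt E H)
    (Vh : Submodule ℝ V) (N : ℕ) (ξ : Fin 2 → Ω → H) (X : ℕ → Ω → H) : Prop where
  adapted : ∀ n ≤ N, Measurable[F (gridPoint hT N n)] (X n)
  mem : ∀ n ≤ N, ∀ᵐ ω ∂P, ∃ x ∈ Vh, ι x = X n ω
  init : ∀ n : Fin 2, X n =ᵐ[P] ξ n
  step : ∀ n, n + 2 ≤ N → ∃ Z Z' : Ω → H,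
    IsNoiseIncrement P e β (fun ω => B (embPreimage ι (X (n + 1) ω)) ω)
      (gridPoint hT N (n + 1)) (gridPoint hT N (n + 2)) Z ∧
    IsNoiseIncrement P e β (fun ω => B (embPreimage ι (X n ω)) ω)
      (gridPoint hT N n) (gridPoint hT N (n + 1)) Z' ∧
    ∀ v ∈ Vh, ∀ᵐ ω ∂P,
      inner ℝ ((3 / 2 : ℝ) • X (n + 2) ω - (2 : ℝ) • X (n + 1) ω + (1 / 2 : ℝ) • X n ω) (ι v)
          + T / N * A (embPreimage ι (X (n + 2) ω)) ω v
        = inner ℝ ((3 / 2 : ℝ) • Z ω - (1 / 2 : ℝ) • Z' ω) (ι v)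

end Scheme

end

/-!
A step of the scheme is an equation `G x = b` in the finite-dimensional space `K = ι(V_h)`, with the
inner product of `H`, for the operator `G x = 3/2 x + k A(x)`. Since `k κ ≤ 3`, the conditions on `A`
make `G` monotone, hemicontinuous, locally bounded and coercive.

*Existence.* The von Neumann-Sion minimax theorem yields finitely many of the inequalities
`⟪G y - b, y - x⟫ ≥ 0` at once, compactness yields all `y` in a ball, and Minty's trick turns them
into `G x = b` (`exists_eq_zero_of_monotone`). For `k κ = 3` the solution need not be unique, so a
measurable selection is required: the solution set is convex, and the solution of minimal norm
depends measurably on the parameters (`exists_measurable_eq_zero`).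

*Noise increments.* For a square integrable, `F_s`-measurable `Φ` the series
`∑_j (β_j(t) - β_j(s)) Φ e_j` has orthogonal terms, hence converges in `L²(Ω; H)`. Solutions of the
scheme need not be square integrable if only `k κ ≤ 3`; for a general `Φ` the series for
`Φ / (1 + ‖Φ‖)` is multiplied by `1 + ‖Φ‖` after passing to the limit in probability
(`IsBrownianFamily.exists_isNoiseIncrement`).

*Uniqueness* and *moments* follow by testing: the difference of two solutions is tested with itself
and monotonicity applies; a solution is tested with itself and coercivity bounds
`‖Xⁿ‖_H² + k ‖B(Xⁿ)‖² + k μ ‖Xⁿ‖_V^p` by the square integrable data of the step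
(`CoefficientConditions.energy_le`), which propagates integrability by induction.
-/

/-! ### Monotone operators on finite-dimensional inner product spaces -/

section MonotoneOperator

variable {K : Type*} [NormedAddCommGroup K] [InnerProductSpace ℝ K]

/-- The Debrunner-Flor inequality for a monotone operator and finitely many points `s`. It follows
from the minimax theorem for the bilinear game on the simplices over `s`: on the diagonal the payoff
is non-positive by monotonicity. -/
theorem exists_mem_convexHull_forall_inner_nonneg {G : K → K}
    (hmono : ∀ x y, 0 ≤ inner ℝ (G x - G y) (x - y)) (s : Finset K) (hs : s.Nonempty) :
    ∃ x ∈ convexHull ℝ (s : Set K), ∀ y ∈ s, 0 ≤ inner ℝ (G y) (y - x) := by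
  classical
  let f : (s → ℝ) → (s → ℝ) → ℝ := fun a b =>
    ∑ i : s, ∑ j : s, a j * b i * inner ℝ (G i) ((j : K) - i)
  have hne : (stdSimplex ℝ s).Nonempty := by
    obtain ⟨x, hx⟩ := hs
    exact ⟨Pi.single ⟨x, hx⟩ 1, single_mem_stdSimplex ℝ _⟩
  have hfl : ∀ b, IsLinearMap ℝ fun a => f a b := fun b => by
    constructor
    · intro x y
      simp only [f, Pi.add_apply, add_mul, Finset.sum_add_distrib]
    · intro r x
      simp only [f, Pi.smul_apply, smul_eq_mul, Finset.mul_sum, mul_assoc]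
  have hfr : ∀ a, IsLinearMap ℝ fun b => f a b := fun a => by
    constructor
    · intro x y
      simp only [f, Pi.add_apply, add_mul, mul_add, Finset.sum_add_distrib]
    · intro r x
      simp only [f, Pi.smul_apply, smul_eq_mul, Finset.mul_sum]
      refine Finset.sum_congr rfl fun i _ => Finset.sum_congr rfl fun j _ => by ring
  have hcl : ∀ b, Continuous fun a => f a b := fun b => by fun_prop
  have hcr : ∀ a, Continuous fun b => f a b := fun a => by fun_prop
  have hconv := convex_stdSimplex ℝ s
  obtain ⟨a, ha, b, hb, hab⟩ := Sion.exists_isSaddlePointOn (f := f) hne hconv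
    (isCompact_stdSimplex ℝ s)
    (fun y _ => (hcl y).lowerSemicontinuous.lowerSemicontinuousOn _)
    (fun y _ => (((hfl y).mk' _).convexOn hconv).quasiconvexOn)
    hconv hne (isCompact_stdSimplex ℝ s)
    (fun x _ => (hcr x).upperSemicontinuous.upperSemicontinuousOn _)
    (fun x _ => (((hfr x).mk' _).concaveOn hconv).quasiconcaveOn)
  have hdiag : f b b ≤ 0 := by
    have h1 : f b b = ∑ i : s, ∑ j : s, b i * b j * inner ℝ (G j) ((i : K) - j) := by
      simp only [f]
      rw [Finset.sum_comm]
    have h2 : 2 * f b b = - ∑ i : s, ∑ j : s, b i * b j * inner ℝ (G i - G j) ((i : K) - j) := by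
      rw [two_mul]
      nth_rewrite 2 [h1]
      simp only [f]
      rw [← Finset.sum_add_distrib, ← Finset.sum_neg_distrib]
      refine Finset.sum_congr rfl fun i _ => ?_
      rw [← Finset.sum_add_distrib, ← Finset.sum_neg_distrib]
      refine Finset.sum_congr rfl fun j _ => ?_
      rw [← neg_sub (i : K) j, inner_neg_right, inner_sub_left]
      ring
    have h3 : 0 ≤ ∑ i : s, ∑ j : s, b i * b j * inner ℝ (G i - G j) ((i : K) - j) :=
      Finset.sum_nonneg fun i _ => Finset.sum_nonneg fun j _ =>
        mul_nonneg (mul_nonneg (hb.1 i) (hb.1 j)) (hmono _ _)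
    linarith
  refine ⟨∑ j : s, a j • (j : K), ?_, fun y hy => ?_⟩
  · exact (convex_convexHull ℝ _).sum_mem (fun j _ => ha.1 j) ha.2
      fun j _ => subset_convexHull ℝ _ j.2
  · have h := (hab b hb (Pi.single ⟨y, hy⟩ 1) (single_mem_stdSimplex ℝ _)).trans hdiag
    have h' : f a (Pi.single ⟨y, hy⟩ 1) = inner ℝ (G y) ((∑ j : s, a j • (j : K)) - y) := by
      have hy' : y = ∑ j : s, a j • y := by rw [← Finset.sum_smul, ha.2, one_smul]
      conv_rhs => rw [show (∑ j : s, a j • (j : K)) - y = ∑ j : s, a j • ((j : K) - y) by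
        simp only [smul_sub, Finset.sum_sub_distrib]; rw [← hy']]
      simp only [f]
      rw [Finset.sum_eq_single (⟨y, hy⟩ : s)]
      · simp [inner_sum, inner_smul_right]
      · intro i _ hi
        simp [Pi.single_eq_of_ne hi]
      · simp
    rw [h'] at h
    rw [← neg_sub, inner_neg_right]
    linarith

theorem inner_nonneg_of_hemicontinuous {G : K → K}
    (hhemi : ∀ x z w, ContinuousOn (fun r : ℝ => inner ℝ (G (x + r • z)) w) (Set.Icc 0 1))
    {x z g : K} (h : ∀ r : ℝ, 0 < r → r ≤ 1 → 0 ≤ inner ℝ (G (x + r • z) - g) z) :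
    0 ≤ inner ℝ (G x - g) z := by
  have h1 : Tendsto (fun r : ℝ => inner ℝ (G (x + r • z) - g) z) (𝓝[Set.Ioc 0 1] 0)
      (𝓝 (inner ℝ (G x - g) z)) := by
    have := ((hhemi x z z) 0 (by simp)).mono_left (nhdsWithin_mono _ Set.Ioc_subset_Icc_self)
    simp only [inner_sub_left]
    simpa using this.sub_const (inner ℝ g z)
  have : (𝓝[Set.Ioc (0 : ℝ) 1] 0).NeBot := by
    rw [← mem_closure_iff_nhdsWithin_neBot, closure_Ioc (by norm_num)]
    simp
  refine ge_of_tendsto h1 ?_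
  filter_upwards [self_mem_nhdsWithin] with r hr using h r hr.1 hr.2

/-- Minty's lemma: for hemicontinuous `G` the inequalities `⟪G y - g, y - x⟫ ≥ 0`, in which `G` is
not evaluated at `x`, already force `G x = g`. -/
theorem eq_of_forall_inner_nonneg {G : K → K}
    (hhemi : ∀ x z w, ContinuousOn (fun r : ℝ => inner ℝ (G (x + r • z)) w) (Set.Icc 0 1))
    {x g : K} (h : ∀ y, 0 ≤ inner ℝ (G y - g) (y - x)) : G x = g := by
  have key : ∀ z, 0 ≤ inner ℝ (G x - g) z := fun z => by
    refine inner_nonneg_of_hemicontinuous hhemi fun r hr _ => ?_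
    have := h (x + r • z)
    rw [add_sub_cancel_left, inner_smul_right] at this
    exact nonneg_of_mul_nonneg_right this hr
  have := key (-(G x - g))
  rw [inner_neg_right, real_inner_self_eq_norm_sq] at this
  have h0 : ‖G x - g‖ = 0 := by nlinarith [norm_nonneg (G x - g)]
  exact sub_eq_zero.1 (norm_eq_zero.1 h0)

theorem convex_setOf_eq_zero_of_monotone {G : K → K}
    (hmono : ∀ x y, 0 ≤ inner ℝ (G x - G y) (x - y))
    (hhemi : ∀ x z w, ContinuousOn (fun r : ℝ => inner ℝ (G (x + r • z)) w) (Set.Icc 0 1)) :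
    Convex ℝ {x | G x = 0} := by
  intro x hx y hy a b ha hb hab
  refine eq_of_forall_inner_nonneg hhemi fun z => ?_
  have h1 := hmono z x
  have h2 := hmono z y
  rw [Set.mem_ofPred_eq] at hx hy
  rw [hx] at h1
  rw [hy] at h2
  have h3 : z - (a • x + b • y) = a • (z - x) + b • (z - y) := by
    have : z = (a + b) • z := by rw [hab, one_smul]
    nth_rewrite 1 [this]
    module
  rw [h3, inner_add_right, inner_smul_right, inner_smul_right]
  positivity

variable [FiniteDimensional ℝ K]

/-- A hemicontinuous monotone operator that points outwards on a sphere has a zero in the ball. -/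
theorem exists_eq_zero_of_monotone {G : K → K}
    (hmono : ∀ x y, 0 ≤ inner ℝ (G x - G y) (x - y))
    (hhemi : ∀ x z w, ContinuousOn (fun r : ℝ => inner ℝ (G (x + r • z)) w) (Set.Icc 0 1))
    {r : ℝ} (hr : 0 < r) (hcoer : ∀ x, ‖x‖ = r → 0 < inner ℝ (G x) x) :
    ∃ x, G x = 0 := by
  obtain ⟨x, hxB, hx⟩ := (isCompact_closedBall (0 : K) r).inter_iInter_nonempty
    (fun y : Metric.closedBall (0 : K) r => {x | 0 ≤ inner ℝ (G y) (y - x)})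
    (fun y => isClosed_le continuous_const (by fun_prop)) (fun u => by
      classical
      rcases u.eq_empty_or_nonempty with rfl | hu
      · exact ⟨0, by simp [hr.le], by simp⟩
      · obtain ⟨x, hx, h⟩ := exists_mem_convexHull_forall_inner_nonneg hmono
          (Finset.image (Subtype.val : Metric.closedBall (0 : K) r → K) u) (hu.image _)
        refine ⟨x, convexHull_min ?_ (convex_closedBall _ _) hx, ?_⟩
        · intro y hy
          obtain ⟨y', -, rfl⟩ := Finset.mem_image.1 (Finset.mem_coe.1 hy)
          exact y'.2
        · simp only [Set.mem_iInter]
          exact fun y hy => h y (Finset.mem_image_of_mem _ hy))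
  simp only [Set.mem_iInter, Set.mem_ofPred_eq, Subtype.forall] at hx
  -- the variational inequality at `x` itself, by letting `y → x` along segments of the ball
  have hvi : ∀ z ∈ Metric.closedBall (0 : K) r, 0 ≤ inner ℝ (G x) (z - x) := fun z hz => by
    have := inner_nonneg_of_hemicontinuous (g := 0) hhemi (x := x) (z := z - x) fun t ht ht1 => by
      have h1 : x + t • (z - x) ∈ Metric.closedBall (0 : K) r :=
        (convex_closedBall (0 : K) r).add_smul_sub_mem hxB hz ⟨ht.le, ht1⟩
      have h2 := hx _ h1
      rw [add_sub_cancel_left, inner_smul_right] at h2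
      rw [sub_zero]
      exact nonneg_of_mul_nonneg_right h2 ht
    rwa [sub_zero] at this
  rw [mem_closedBall_zero_iff] at hxB
  have hlt : ‖x‖ < r := by
    refine lt_of_le_of_ne hxB fun h => ?_
    have h1 := hvi 0 (by simp [hr.le])
    rw [zero_sub, inner_neg_right] at h1
    linarith [hcoer x h]
  refine ⟨x, ?_⟩
  by_contra hne
  have hpos : 0 < ‖G x‖ := norm_pos_iff.2 hne
  set t := (r - ‖x‖) / ‖G x‖
  have ht : 0 < t := div_pos (sub_pos.2 hlt) hpos
  have h1 := hvi (x - t • G x) (by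
    rw [mem_closedBall_zero_iff]
    refine (norm_sub_le _ _).trans ?_
    rw [norm_smul, Real.norm_of_nonneg ht.le, div_mul_cancel₀ _ hpos.ne']
    linarith)
  rw [sub_sub_cancel_left, inner_neg_right, inner_smul_right, real_inner_self_eq_norm_sq] at h1
  have : 0 < t * ‖G x‖ ^ 2 := by positivity
  linarith

/-- In finite dimensions a locally bounded, hemicontinuous monotone operator is continuous. -/
theorem continuous_of_monotone {G : K → K}
    (hmono : ∀ x y, 0 ≤ inner ℝ (G x - G y) (x - y))
    (hhemi : ∀ x z w, ContinuousOn (fun r : ℝ => inner ℝ (G (x + r • z)) w) (Set.Icc 0 1))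
    (hbdd : ∀ r : ℝ, ∃ M : ℝ, ∀ x, ‖x‖ ≤ r → ‖G x‖ ≤ M) : Continuous G := by
  refine continuous_iff_continuousAt.2 fun x => ?_
  obtain ⟨M, hM⟩ := hbdd (‖x‖ + 1)
  refine (isCompact_closedBall (0 : K) M).tendsto_nhds_of_unique_mapClusterPt ?_ ?_
  · have : ∀ᶠ y in 𝓝 x, ‖y‖ < ‖x‖ + 1 :=
      continuous_norm.continuousAt.eventually_lt_const (by linarith)
    filter_upwards [this] with y hy
    exact mem_closedBall_zero_iff.2 (hM y hy.le)
  · intro g _ hg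
    obtain ⟨u, hu, hug⟩ := mapClusterPt_iff_ultrafilter.1 hg
    refine (eq_of_forall_inner_nonneg hhemi fun y => ?_).symm
    have hlim : Tendsto (fun v => inner ℝ (G y - G v) (y - v)) u (𝓝 (inner ℝ (G y - g) (y - x))) :=
      (tendsto_const_nhds.sub hug).inner (tendsto_const_nhds.sub hu)
    exact ge_of_tendsto' hlim fun v => hmono y v

end MonotoneOperator

/-! ### Measurable selection of zeros -/

section Selection

variable {K : Type*} [NormedAddCommGroup K] [InnerProductSpace ℝ K] [FiniteDimensional ℝ K]
  [MeasurableSpace K] [BorelSpace K] {Ω : Type*} {m : MeasurableSpace Ω}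

/-- On a compact set `G ω` has a zero iff its norm is arbitrarily small on a countable dense subset. -/
theorem measurableSet_exists_mem_eq_zero {G : Ω → K → K} (hG : ∀ ω, Continuous (G ω))
    (hGm : ∀ y, Measurable fun ω => G ω y) {C : Set K} (hC : IsCompact C) :
    MeasurableSet {ω | ∃ x ∈ C, G ω x = 0} := by
  rcases C.eq_empty_or_nonempty with rfl | hne
  · simp
  have := hne.to_subtype
  have : {ω | ∃ x ∈ C, G ω x = 0} =
      ⋂ k : ℕ, ⋃ n : ℕ, {ω | ‖G ω (TopologicalSpace.denseSeq C n)‖ < 1 / ((k : ℝ) + 1)} := by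
    ext ω
    simp only [Set.mem_ofPred_eq, Set.mem_iInter, Set.mem_iUnion]
    constructor
    · rintro ⟨x, hx, h0⟩ k
      have hopen : IsOpen {y : C | ‖G ω y‖ < 1 / ((k : ℝ) + 1)} :=
        isOpen_lt (((hG ω).comp continuous_subtype_val).norm) continuous_const
      obtain ⟨n, hn⟩ := (TopologicalSpace.denseRange_denseSeq C).exists_mem_open hopen
        ⟨⟨x, hx⟩, by simp only [Set.mem_ofPred_eq, h0, norm_zero]; positivity⟩
      exact ⟨n, hn⟩
    · intro h
      obtain ⟨x, hx, hmin⟩ := hC.exists_isMinOn hne (hG ω).norm.continuousOn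
      refine ⟨x, hx, norm_eq_zero.1 (le_antisymm ?_ (norm_nonneg _))⟩
      refine le_of_forall_pos_le_add fun ε hε => ?_
      obtain ⟨k, hk⟩ := exists_nat_one_div_lt hε
      obtain ⟨n, hn⟩ := h k
      have := hmin (TopologicalSpace.denseSeq C n).2
      simp only [Set.mem_ofPred_eq] at this
      linarith
  rw [this]
  exact MeasurableSet.iInter fun k => MeasurableSet.iUnion fun n =>
    measurableSet_lt (hGm _).norm measurable_const

/-- If the zero sets of a Carathéodory function `G` are non-empty and convex, then the zero of
minimal norm is a measurable function of the parameter. -/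
theorem exists_measurable_eq_zero {G : Ω → K → K} (hG : ∀ ω, Continuous (G ω))
    (hGm : ∀ y, Measurable fun ω => G ω y) (hne : ∀ ω, ∃ x, G ω x = 0)
    (hconv : ∀ ω, Convex ℝ {x | G ω x = 0}) :
    ∃ x : Ω → K, Measurable x ∧ ∀ ω, G ω (x ω) = 0 := by
  have hcl : ∀ ω, IsClosed {x | G ω x = 0} := fun ω => isClosed_eq (hG ω) continuous_const
  have hex : ∀ ω, ∃ x, G ω x = 0 ∧ ∀ y, G ω y = 0 → 0 ≤ inner ℝ x (y - x) := fun ω => by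
    obtain ⟨x, hx, hmin⟩ := exists_norm_eq_iInf_of_complete_convex (K := {x | G ω x = 0}) (hne ω)
      (hcl ω).isComplete (hconv ω) 0
    refine ⟨x, hx, fun y hy => ?_⟩
    have := (norm_eq_iInf_iff_real_inner_le_zero (hconv ω) hx).1 hmin y hy
    rw [zero_sub, inner_neg_left] at this
    linarith
  choose x hx hmin using hex
  have hle : ∀ ω y, G ω y = 0 → ‖x ω‖ ≤ ‖y‖ := fun ω y hy => by
    have h1 := hmin ω y hy
    rw [inner_sub_right, real_inner_self_eq_norm_sq] at h1
    have h2 := real_inner_le_norm (x ω) y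
    nlinarith [norm_nonneg (x ω), norm_nonneg y]
  have huniq : ∀ ω y, G ω y = 0 → ‖y‖ ≤ ‖x ω‖ → y = x ω := fun ω y hy hyx => by
    have h1 := hmin ω y hy
    have h2 := norm_sub_sq_real y (x ω)
    rw [inner_sub_right, real_inner_self_eq_norm_sq, real_inner_comm] at h1
    have h3 : ‖y - x ω‖ = 0 := by 
      have h4 : ‖y‖ ^ 2 ≤ ‖x ω‖ ^ 2 := pow_le_pow_left₀ (norm_nonneg _) hyx 2
      have h5 : ‖y - x ω‖ ^ 2 = 0 := le_antisymm (by linarith) (sq_nonneg _)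
      exact pow_eq_zero_iff two_ne_zero |>.1 h5
    exact sub_eq_zero.1 (norm_eq_zero.1 h3)
  refine ⟨x, ?_, hx⟩
  have hnorm : Measurable fun ω => ‖x ω‖ := by
    refine measurable_of_Iic fun r => ?_
    convert! measurableSet_exists_mem_eq_zero hG hGm (isCompact_closedBall (0 : K) r) using 1
    ext ω
    simp only [Set.mem_preimage, Set.mem_Iic, mem_closedBall_zero_iff, Set.mem_ofPred_eq]
    exact ⟨fun h => ⟨x ω, h, hx ω⟩, fun ⟨y, hy, h0⟩ => (hle ω y h0).trans hy⟩
  refine measurable_of_isClosed fun C hC => ?_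
  have : x ⁻¹' C = ⋂ q : ℚ, {ω | ‖x ω‖ ≤ q}ᶜ ∪
      {ω | ∃ y ∈ C ∩ Metric.closedBall (0 : K) q, G ω y = 0} := by
    ext ω
    simp only [Set.mem_preimage, Set.mem_iInter, Set.mem_union, Set.mem_compl_iff,
      Set.mem_ofPred_eq, Set.mem_inter_iff, mem_closedBall_zero_iff]
    constructor
    · intro h q
      by_cases hq : ‖x ω‖ ≤ q
      · exact Or.inr ⟨x ω, ⟨h, hq⟩, hx ω⟩
      · exact Or.inl hq
    · intro h
      have h' : ∀ q : ℚ, ‖x ω‖ < q → ∃ y, (y ∈ C ∧ ‖y‖ ≤ q) ∧ G ω y = 0 :=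
        fun q hq => (h q).resolve_left (not_not.2 hq.le)
      -- a zero of minimal norm in `C` has norm at most every rational above `‖x ω‖`
      obtain ⟨q₀, hq₀, -⟩ := exists_rat_btwn (lt_add_one ‖x ω‖)
      obtain ⟨y₀, ⟨hy₀C, hy₀⟩, hy₀0⟩ := h' q₀ hq₀
      obtain ⟨y, ⟨⟨hyC, hy0⟩, -⟩, hymin⟩ :=
        ((isCompact_closedBall (0 : K) q₀).inter_left (hC.inter (hcl ω))).exists_isMinOn
          ⟨y₀, ⟨hy₀C, hy₀0⟩, mem_closedBall_zero_iff.2 hy₀⟩ continuous_norm.continuousOn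
      have hyx : ‖y‖ ≤ ‖x ω‖ := by
        by_contra! hlt
        obtain ⟨q, hq1, hq2⟩ := exists_rat_btwn (lt_min hlt hq₀)
        obtain ⟨z, ⟨hzC, hz⟩, hz0⟩ := h' q hq1
        have hzy : ‖y‖ ≤ ‖z‖ := hymin ⟨⟨hzC, hz0⟩,
          mem_closedBall_zero_iff.2 (hz.trans (hq2.le.trans (min_le_right _ _)))⟩
        exact absurd (hzy.trans hz) (not_le.2 (hq2.trans_le (min_le_left _ _)))
      rw [← huniq ω y hy0 hyx]
      exact hyC
  rw [this]
  exact MeasurableSet.iInter fun q => (measurableSet_le hnorm measurable_const).compl.union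
    (measurableSet_exists_mem_eq_zero hG hGm ((isCompact_closedBall _ _).inter_left hC))

end Selection

/-! ### The Hilbert-Schmidt norm in an arbitrary orthonormal basis -/

section HilbertSchmidtBasis

theorem HilbertBasis.tsum_ofReal_inner_sq {ι E : Type*} [NormedAddCommGroup E]
    [InnerProductSpace ℝ E] (b : HilbertBasis ι ℝ E) (x : E) :
    ∑' i, ENNReal.ofReal (inner ℝ (b i) x ^ 2) = ENNReal.ofReal (‖x‖ ^ 2) := by
  have h := b.hasSum_inner_mul_inner x x
  have h' : (fun i => inner ℝ x (b i) * inner ℝ (b i) x) = fun i => inner ℝ (b i) x ^ 2 := by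
    funext i
    rw [real_inner_comm, sq]
  rw [h', real_inner_self_eq_norm_sq] at h
  rw [← h.tsum_eq, ENNReal.ofReal_tsum_of_nonneg (fun i => sq_nonneg _) h.summable]

theorem HilbertBasis.countable {ι E : Type*} [NormedAddCommGroup E] [InnerProductSpace ℝ E]
    [TopologicalSpace.SeparableSpace E] (b : HilbertBasis ι ℝ E) : Countable ι := by
  refine Set.countable_univ_iff.1 ?_
  refine Set.PairwiseDisjoint.countable_of_isOpen (s := fun i => Metric.ball (b i) (1 / 2))
    (fun i _ j _ hij => ?_) (fun i _ => Metric.isOpen_ball)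
    (fun i _ => Metric.nonempty_ball.2 (by norm_num))
  refine Metric.ball_disjoint_ball ?_
  have h1 : ‖b i - b j‖ ^ 2 = 2 := by
    rw [norm_sub_sq_real, b.orthonormal.1 i, b.orthonormal.1 j, b.orthonormal.2 hij]
    norm_num
  rw [dist_eq_norm]
  nlinarith [norm_nonneg (b i - b j)]

variable {E : Type*} [NormedAddCommGroup E] [InnerProductSpace ℝ E] [CompleteSpace E]
  {H : Type*} [NormedAddCommGroup H] [InnerProductSpace ℝ H] [CompleteSpace H]

theorem tsum_ofReal_norm_sq_eq_adjoint {ι κ : Type*} (b : HilbertBasis ι ℝ E)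
    (f : HilbertBasis κ ℝ H) (L : E →L[ℝ] H) :
    ∑' i, ENNReal.ofReal (‖L (b i)‖ ^ 2) =
      ∑' k, ENNReal.ofReal (‖ContinuousLinearMap.adjoint L (f k)‖ ^ 2) := by
  simp_rw [← f.tsum_ofReal_inner_sq, ← b.tsum_ofReal_inner_sq]
  rw [ENNReal.tsum_comm]
  simp_rw [ContinuousLinearMap.adjoint_inner_right, real_inner_comm]

/-- Both bases of `E` are compared with the adjoint evaluated at an orthonormal basis of `H`. -/
theorem HilbertSchmidt.sum_norm_sq_le {J : Type*} (e : HilbertBasis J ℝ E)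
    (b : HilbertSchmidt E H) (S : Finset J) :
    ∑ j ∈ S, ‖HilbertSchmidt.toCLM E H b (e j)‖ ^ 2 ≤ ‖b‖ ^ 2 := by
  obtain ⟨w, f, -⟩ := exists_hilbertBasis ℝ H
  have hsum : Summable fun i => ‖HilbertSchmidt.toCLM E H b (onb E i)‖ ^ 2 := by
    have := (memℓp_gen_iff (p := 2) (by norm_num)).1 b.2
    simp only [ENNReal.toReal_ofNat, Real.rpow_ofNat] at this
    exact this
  have h : ENNReal.ofReal (∑ j ∈ S, ‖HilbertSchmidt.toCLM E H b (e j)‖ ^ 2) ≤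
      ENNReal.ofReal (‖b‖ ^ 2) := by
    rw [ENNReal.ofReal_sum_of_nonneg fun _ _ => sq_nonneg _, HilbertSchmidt.norm_sq_eq,
      ENNReal.ofReal_tsum_of_nonneg (fun _ => sq_nonneg _) hsum,
      tsum_ofReal_norm_sq_eq_adjoint (onb E) f, ← tsum_ofReal_norm_sq_eq_adjoint e f]
    exact ENNReal.sum_le_tsum S
  exact (ENNReal.ofReal_le_ofReal_iff (sq_nonneg _)).1 h

theorem HilbertSchmidt.continuous_toCLM_apply {J : Type*} (e : HilbertBasis J ℝ E) (j : J) :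
    Continuous fun b : HilbertSchmidt E H => HilbertSchmidt.toCLM E H b (e j) := by
  let f : HilbertSchmidt E H →+ H :=
    { toFun := fun b => HilbertSchmidt.toCLM E H b (e j)
      map_zero' := by simp
      map_add' := fun a b => by simp }
  refine AddMonoidHomClass.continuous_of_bound f 1 fun b => ?_
  rw [one_mul]
  have := HilbertSchmidt.sum_norm_sq_le e b {j}
  rw [Finset.sum_singleton] at this
  exact (pow_le_pow_iff_left₀ (norm_nonneg _) (norm_nonneg _) two_ne_zero).1 this

end HilbertSchmidtBasis

instance {U : Type*} [NormedAddCommGroup U] [InnerProductSpace ℝ U] [CompleteSpace U]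
    [TopologicalSpace.SeparableSpace U] (R : U →L[ℝ] U) :
    TopologicalSpace.SeparableSpace (CameronMartin R) :=
  (CameronMartin.isometryEquiv R).surjective.denseRange.separableSpace
    (CameronMartin.isometryEquiv R).continuous

/-! ### Complete filtrations and convergence in probability -/

section Complete

variable {Ω : Type*} {mΩ : MeasurableSpace Ω} {P : Measure Ω}

/-- With respect to a complete filtration measurability is insensitive to null sets. -/
theorem UsualConditions.measurable_of_ae_eq {T : ℝ} {F : Filtration (Set.Icc (0 : ℝ) T) mΩ}
    (hF : UsualConditions P F) {γ : Type*} [MeasurableSpace γ] {t : Set.Icc (0 : ℝ) T}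
    {f g : Ω → γ} (hg : Measurable[F t] g) (hfg : f =ᵐ[P] g) : Measurable[F t] f := by
  intro s hs
  have hnull : ∀ u ⊆ {ω | f ω ≠ g ω}, MeasurableSet[F t] u := fun u hu =>
    hF.complete t u (measure_mono_null hu hfg)
  have : f ⁻¹' s = (g ⁻¹' s \ {ω | f ω ≠ g ω}) ∪ (f ⁻¹' s ∩ {ω | f ω ≠ g ω}) := by
    ext ω
    by_cases h : f ω = g ω <;> simp [h]
  rw [this]
  exact ((hg hs).diff (hnull _ subset_rfl)).union (hnull _ Set.inter_subset_right)

/-- Convergence in probability is preserved by multiplication with a fixed random variable, whatever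
its integrability. -/
theorem MeasureTheory.TendstoInMeasure.smul_of_measurable [IsFiniteMeasure P] {H : Type*}
    [NormedAddCommGroup H] [NormedSpace ℝ H] {ι : Type*} {l : Filter ι} {f : ι → Ω → H} {g : Ω → H}
    (h : TendstoInMeasure P f l g) {r : Ω → ℝ} (hr : Measurable r) :
    TendstoInMeasure P (fun i ω => r ω • f i ω) l fun ω => r ω • g ω := by
  rw [tendstoInMeasure_iff_norm] at h ⊢
  intro ε hε
  have htail : Tendsto (fun n : ℕ => P {ω | (n : ℝ) ≤ |r ω|}) atTop (𝓝 0) := by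
    have hanti : Antitone fun n : ℕ => {ω | (n : ℝ) ≤ |r ω|} := fun a b hab ω hω =>
      show (a : ℝ) ≤ |r ω| from (Nat.cast_le.2 hab).trans (show (b : ℝ) ≤ |r ω| from hω)
    have := tendsto_measure_iInter_atTop (μ := P)
      (fun n : ℕ => (measurableSet_le measurable_const hr.abs).nullMeasurableSet) hanti
      ⟨0, measure_ne_top P _⟩
    have hempty : ⋂ n : ℕ, {ω | (n : ℝ) ≤ |r ω|} = ∅ := by
      refine Set.eq_empty_of_forall_notMem fun ω hω => ?_
      obtain ⟨n, hn⟩ := exists_nat_gt |r ω|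
      exact absurd (Set.mem_iInter.1 hω n) (not_le.2 hn)
    rwa [hempty, measure_empty] at this
  refine ENNReal.tendsto_nhds_zero.2 fun δ hδ => ?_
  have hδ2 : 0 < δ / 2 := ENNReal.half_pos hδ.ne'
  obtain ⟨n, hn, hn0⟩ := ((ENNReal.tendsto_nhds_zero.1 htail _ hδ2).and
    (eventually_gt_atTop 0)).exists
  have hn0' : (0 : ℝ) < n := Nat.cast_pos.2 hn0
  filter_upwards [ENNReal.tendsto_nhds_zero.1 (h (ε / n) (div_pos hε hn0')) _ hδ2] with i hi
  calc P {ω | ε ≤ ‖r ω • f i ω - r ω • g ω‖}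
      ≤ P ({ω | (n : ℝ) ≤ |r ω|} ∪ {ω | ε / n ≤ ‖f i ω - g ω‖}) := by
        refine measure_mono fun ω hω => ?_
        rw [Set.mem_union, or_iff_not_imp_left]
        intro hlt
        simp only [Set.mem_ofPred_eq, not_le] at hlt hω ⊢
        rw [← smul_sub, norm_smul, Real.norm_eq_abs] at hω
        rw [div_le_iff₀ hn0', mul_comm]
        exact hω.trans (mul_le_mul_of_nonneg_right hlt.le (norm_nonneg _))
    _ ≤ δ / 2 + δ / 2 := (measure_union_le _ _).trans (add_le_add hn hi)
    _ = δ := ENNReal.add_halves δ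

end Complete

/-! ### Noise increments -/

section Increment

variable {Ω : Type*} {mΩ : MeasurableSpace Ω} {P : Measure Ω} {H : Type*} [NormedAddCommGroup H]
  [InnerProductSpace ℝ H] {E : Type*} [NormedAddCommGroup E] [InnerProductSpace ℝ E]
  [CompleteSpace E] {T : ℝ} {F : Filtration (Set.Icc (0 : ℝ) T) mΩ} {J : Type*}
  {β : J → Set.Icc (0 : ℝ) T → Ω → ℝ} {Φ : Ω → HilbertSchmidt E H} {s t : Set.Icc (0 : ℝ) T}

/-- Limits in probability are unique; `J` is countable, so that the net of finite partial sums
has an almost surely convergent subsequence. -/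
theorem IsNoiseIncrement.ae_eq [Countable J] {e : HilbertBasis J ℝ E} {Z Z' : Ω → H}
    {Φ' : Ω → HilbertSchmidt E H} (h : IsNoiseIncrement P e β Φ s t Z)
    (h' : IsNoiseIncrement P e β Φ' s t Z') (hΦ : Φ =ᵐ[P] Φ') : Z =ᵐ[P] Z' := by
  refine tendstoInMeasure_ae_unique h (TendstoInMeasure.congr_left (fun S => ?_) h')
  filter_upwards [hΦ] with ω hω
  simp [hω]

theorem IsBrownianFamily.measurable_increment (hβ : IsBrownianFamily P F β) (hst : s ≤ t) (j : J) :
    Measurable[F t] fun ω => β j t ω - β j s ω :=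
  (hβ.adapted j t).sub ((hβ.adapted j s).mono (F.mono hst) le_rfl)

end Increment

section Noise

theorem summable_of_pairwise_inner_eq_zero {ι E : Type*} [NormedAddCommGroup E]
    [InnerProductSpace ℝ E] [CompleteSpace E] {f : ι → E}
    (hf : ∀ i j, i ≠ j → inner ℝ (f i) (f j) = 0) (hs : Summable fun i => ‖f i‖ ^ 2) :
    Summable f := by
  have h : OrthogonalFamily ℝ (fun i => (ℝ ∙ f i : Submodule ℝ E))
      fun i => (ℝ ∙ f i : Submodule ℝ E).subtypeₗᵢ :=
    OrthogonalFamily.of_pairwise fun i j hij => by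
      refine Submodule.isOrtho_span.2 ?_
      rintro _ rfl _ rfl
      exact hf i j hij
  exact (h.summable_iff_norm_sq_summable
    fun i => ⟨f i, Submodule.mem_span_singleton_self (f i)⟩).2 hs

variable {Ω : Type*} {m mΩ : MeasurableSpace Ω} {P : Measure Ω}
  {H : Type*} [NormedAddCommGroup H] [InnerProductSpace ℝ H] [CompleteSpace H]
  [TopologicalSpace.SeparableSpace H] [MeasurableSpace H] [BorelSpace H]

/-- Square integrable coefficients `φ_j` that are independent of the centred, independent Gaussian
increments `D_j`: the terms `D_j φ_j` are orthogonal in `L²`, so `∑ D_j φ_j` converges in `L²`. -/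
theorem exists_memLp_tendstoInMeasure_sum (hm : m ≤ mΩ) {J : Type*}
    {φ : J → Ω → H} (hφ : ∀ j, Measurable[m] (φ j)) {g : Ω → ℝ} (hg : MemLp g 2 P)
    (hφg : ∀ (S : Finset J) ω, ∑ j ∈ S, ‖φ j ω‖ ^ 2 ≤ g ω ^ 2) {D : J → Ω → ℝ}
    (hD : ∀ j, Measurable (D j)) {v : ℝ≥0} (hlaw : ∀ j, P.map (D j) = gaussianReal 0 v)
    (hind : iIndepFun D P)
    (hpast : Indep m (MeasurableSpace.comap (fun ω j => D j ω) MeasurableSpace.pi) P) :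
    ∃ Z : Ω → H, MemLp Z 2 P ∧
      TendstoInMeasure P (fun (S : Finset J) ω => ∑ j ∈ S, D j ω • φ j ω) atTop Z := by
  have hindep : ∀ (q : (J → ℝ) → ℝ) (r : Ω → ℝ), Measurable q → Measurable[m] r →
      IndepFun (fun ω => q fun j => D j ω) r P := fun q r hq hr => by
    refine (IndepFun_iff_Indep _ _ _).2 (indep_of_indep_of_le hpast hr.comap_le ?_).symm
    rw [← Function.comp_def q, ← MeasurableSpace.comap_comp]
    exact MeasurableSpace.comap_mono hq.comap_le
  have hφ' : ∀ j, Measurable (φ j) := fun j => (hφ j).mono hm le_rfl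
  have hφL : ∀ j, MemLp (φ j) 2 P := fun j =>
    hg.mono (hφ' j).aestronglyMeasurable (ae_of_all _ fun ω => by
      have := hφg {j} ω
      rw [Finset.sum_singleton] at this
      rw [Real.norm_eq_abs]
      exact (abs_norm (φ j ω)) ▸ sq_le_sq.1 this)
  have hDL : ∀ j, MemLp (D j) 2 P := fun j => by
    have h1 : MemLp id 2 (P.map (D j)) := by
      rw [hlaw j]
      exact memLp_id_gaussianReal' 2 (by simp)
    exact (memLp_map_measure_iff aestronglyMeasurable_id (hD j).aemeasurable).1 h1
  have hDint : ∀ j, ∫ ω, D j ω ∂P = 0 := fun j => by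
    have h1 := integral_map (μ := P) (hD j).aemeasurable (f := fun x : ℝ => x)
      aestronglyMeasurable_id
    rw [hlaw j, integral_id_gaussianReal] at h1
    exact h1.symm
  have hDsq : ∀ j, ∫ ω, D j ω ^ 2 ∂P = ∫ x, x ^ 2 ∂gaussianReal 0 v := fun j => by
    rw [← hlaw j, integral_map (hD j).aemeasurable (by fun_prop)]
  have hfL : ∀ j, MemLp (fun ω => D j ω • φ j ω) 2 P := fun j => by
    refine (memLp_two_iff_integrable_sq_norm
      ((hD j).smul (hφ' j)).aestronglyMeasurable).2 ?_
    have h1 := (hindep (fun x => x j ^ 2) (fun ω => ‖φ j ω‖ ^ 2) (by fun_prop)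
      ((measurable_norm.pow_const 2).comp (hφ j))).integrable_mul (hDL j).integrable_sq
      ((memLp_two_iff_integrable_sq_norm (hφ' j).aestronglyMeasurable).1 (hφL j))
    refine h1.congr (ae_of_all _ fun ω => ?_)
    simp [norm_smul, mul_pow]
  let f : J → Lp H 2 P := fun j => (hfL j).toLp _
  have hinner : ∀ i j, inner ℝ (f i) (f j) =
      (∫ ω, D i ω * D j ω ∂P) * ∫ ω, inner ℝ (φ i ω) (φ j ω) ∂P := fun i j => by
    have h1 := (hindep (fun x => x i * x j) (fun ω => inner ℝ (φ i ω) (φ j ω)) (by fun_prop)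
      ((hφ i).inner (hφ j))).integral_mul_eq_mul_integral
      ((hD i).mul (hD j)).aestronglyMeasurable
      ((hφ' i).inner (hφ' j)).aestronglyMeasurable
    rw [L2.inner_def, ← h1]
    refine integral_congr_ae ?_
    filter_upwards [(hfL i).coeFn_toLp, (hfL j).coeFn_toLp] with ω hi hj
    simp only [f, hi, hj, inner_smul_left, inner_smul_right, Pi.mul_apply]
    simp only [conj_trivial]
    ring
  have hsum : Summable f := by
    refine summable_of_pairwise_inner_eq_zero (fun i j hij => ?_) ?_
    · rw [hinner, (hind.indepFun hij).integral_fun_mul_eq_mul_integral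
        (hD i).aestronglyMeasurable (hD j).aestronglyMeasurable, hDint, zero_mul, zero_mul]
    · refine summable_of_sum_le (c := (∫ x, x ^ 2 ∂gaussianReal 0 v) * ∫ ω, g ω ^ 2 ∂P)
        (fun _ => sq_nonneg _) fun S => ?_
      have h1 : ∀ j, ‖f j‖ ^ 2 = (∫ x, x ^ 2 ∂gaussianReal 0 v) * ∫ ω, ‖φ j ω‖ ^ 2 ∂P := fun j => by
        rw [← real_inner_self_eq_norm_sq, hinner, ← hDsq j]
        simp only [real_inner_self_eq_norm_sq, sq]
      simp_rw [h1]
      rw [← Finset.mul_sum, ← integral_finsetSum _ fun j _ =>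
        (memLp_two_iff_integrable_sq_norm (hφ' j).aestronglyMeasurable).1 (hφL j)]
      refine mul_le_mul_of_nonneg_left ?_ (integral_nonneg fun x => sq_nonneg x)
      exact integral_mono (integrable_finsetSum _ fun j _ =>
        (memLp_two_iff_integrable_sq_norm (hφ' j).aestronglyMeasurable).1 (hφL j))
        hg.integrable_sq (hφg S)
  obtain ⟨Z, hZ⟩ := hsum
  refine ⟨Z, Lp.memLp Z, (tendstoInMeasure_of_tendsto_Lp hZ).congr_left fun S => ?_⟩
  refine (Lp.coeFn_fun_finsetSum S f).trans ?_
  have := (Filter.eventually_all_finset S).2 fun j _ => (hfL j).coeFn_toLp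
  filter_upwards [this] with ω hω
  exact Finset.sum_congr rfl fun j hj => hω j hj

variable {E : Type*} [NormedAddCommGroup E] [InnerProductSpace ℝ E] [CompleteSpace E]
  {T : ℝ} {F : Filtration (Set.Icc (0 : ℝ) T) mΩ} {J : Type*}
  {β : J → Set.Icc (0 : ℝ) T → Ω → ℝ} {Φ : Ω → HilbertSchmidt E H} {s t : Set.Icc (0 : ℝ) T}

/-- For square integrable integrands the noise increment exists and is square integrable. -/
theorem IsBrownianFamily.exists_isNoiseIncrement_memLp (hβ : IsBrownianFamily P F β)
    (e : HilbertBasis J ℝ E) (hst : s ≤ t) (hΦ : Measurable[F s] Φ) (hΦ2 : MemLp (fun ω => ‖Φ ω‖) 2 P) :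
    ∃ Z, MemLp Z 2 P ∧ IsNoiseIncrement P e β Φ s t Z :=
  exists_memLp_tendstoInMeasure_sum (F.le s)
    (fun j => (HilbertSchmidt.continuous_toCLM_apply e j).measurable.comp hΦ) hΦ2
    (fun S ω => HilbertSchmidt.sum_norm_sq_le e (Φ ω) S)
    (fun j => (hβ.measurable_increment hst j).mono (F.le t) le_rfl)
    (fun j => hβ.law j s t hst) (hβ.indep s t hst) (hβ.indep_past s t hst)

/-- For arbitrary adapted integrands the noise increment exists: `Φ / (1 + ‖Φ‖)` is bounded, and
the factor `1 + ‖Φ‖` is restored after taking the limit in probability. -/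
theorem IsBrownianFamily.exists_isNoiseIncrement [IsFiniteMeasure P] [Countable J] (hF : UsualConditions P F)
    (hβ : IsBrownianFamily P F β)
    (e : HilbertBasis J ℝ E) (hst : s ≤ t) (hΦ : Measurable[F s] Φ) :
    ∃ Z, Measurable[F t] Z ∧ IsNoiseIncrement P e β Φ s t Z := by
  have hΦn : Measurable[F s] fun ω => ‖Φ ω‖ := measurable_norm.comp hΦ
  have hΦj : ∀ j, Measurable[F s] fun ω => HilbertSchmidt.toCLM E H (Φ ω) (e j) := fun j =>
    (HilbertSchmidt.continuous_toCLM_apply e j).measurable.comp hΦ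
  have hpos : ∀ ω, 0 < 1 + ‖Φ ω‖ := fun ω => by positivity
  obtain ⟨Z, -, hZ⟩ := exists_memLp_tendstoInMeasure_sum (P := P) (F.le s)
    (φ := fun j ω => (1 + ‖Φ ω‖)⁻¹ • HilbertSchmidt.toCLM E H (Φ ω) (e j))
    (fun j => (hΦn.const_add 1).inv.smul (hΦj j)) (memLp_const (1 : ℝ))
    (fun S ω => by
      simp only [norm_smul, mul_pow]
      rw [← Finset.mul_sum, norm_inv, Real.norm_of_nonneg (hpos ω).le, inv_pow, one_pow,
        inv_mul_le_one₀ (pow_pos (hpos ω) 2)]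
      refine (HilbertSchmidt.sum_norm_sq_le e (Φ ω) S).trans ?_
      exact pow_le_pow_left₀ (norm_nonneg _) (by linarith) 2)
    (fun j => (hβ.measurable_increment hst j).mono (F.le t) le_rfl)
    (fun j => hβ.law j s t hst) (hβ.indep s t hst) (hβ.indep_past s t hst)
  have h : IsNoiseIncrement P e β Φ s t fun ω => (1 + ‖Φ ω‖) • Z ω := by
    refine (hZ.smul_of_measurable ((hΦn.mono (F.le s) le_rfl).const_add 1)).congr_left
      fun S => ae_of_all _ fun ω => ?_
    simp only [Finset.smul_sum]
    refine Finset.sum_congr rfl fun j _ => ?_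
    rw [smul_comm, smul_inv_smul₀ (hpos ω).ne']
  refine ⟨_, ?_, h⟩
  have hS : ∀ S : Finset J, Measurable[F t] fun ω =>
      ∑ j ∈ S, (β j t ω - β j s ω) • HilbertSchmidt.toCLM E H (Φ ω) (e j) := fun S =>
    Finset.measurable_fun_sum S fun j _ =>
      (hβ.measurable_increment hst j).smul ((hΦj j).mono (F.mono hst) le_rfl)
  obtain ⟨ns, -, hlim⟩ := h.exists_seq_tendsto_ae'
  -- remove the null set on which the partial sums diverge; it belongs to `F t` by completeness
  set A : Set Ω := {ω | Tendsto (fun n => ∑ j ∈ ns n,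
    (β j t ω - β j s ω) • HilbertSchmidt.toCLM E H (Φ ω) (e j)) atTop (𝓝 ((1 + ‖Φ ω‖) • Z ω))}
  have hA : MeasurableSet[F t] A := (compl_compl A) ▸ (hF.complete t Aᶜ hlim).compl
  refine hF.measurable_of_ae_eq (g := A.indicator fun ω => (1 + ‖Φ ω‖) • Z ω) ?_ ?_
  · refine @measurable_of_tendsto_metrizable _ _ (F t) _ _ _ _ _ _
      (fun n => Measurable.indicator (m := F t) (hS (ns n)) hA) (tendsto_pi_nhds.2 fun ω => ?_)
    by_cases hω : ω ∈ A
    · simp only [Set.indicator_of_mem hω]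
      exact hω
    · simp only [Set.indicator_of_notMem hω, tendsto_const_nhds]
  · filter_upwards [hlim] with ω hω
    rw [Set.indicator_of_mem (show ω ∈ A from hω)]

end Noise

/-! ### The nonlinear operator of one time step -/

section OneStep

variable {V : Type*} [NormedAddCommGroup V] [NormedSpace ℝ V]
  {H : Type*} [NormedAddCommGroup H] [InnerProductSpace ℝ H]
  {K : Type*} [NormedAddCommGroup K] [InnerProductSpace ℝ K] [FiniteDimensional ℝ K]
  {Ω : Type*} {E : Type*} [NormedAddCommGroup E] [InnerProductSpace ℝ E] [CompleteSpace E]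

/-- The operator `x ↦ 3/2 x + k A(x)` on a finite-dimensional space `K` which is embedded into `V`
by `j`; the functional `A (j x) ω ∘ j` is identified with an element of `K`. -/
noncomputable def stepOperator (j : K →L[ℝ] V) (A : V → Ω → StrongDual ℝ V) (k : ℝ) (ω : Ω) (x : K) : K :=
  (3 / 2 : ℝ) • x + k • (InnerProductSpace.toDual ℝ K).symm ((A (j x) ω).comp j)

theorem inner_stepOperator (j : K →L[ℝ] V) (A : V → Ω → StrongDual ℝ V) (k : ℝ) (ω : Ω) (x y : K) :
    inner ℝ (stepOperator j A k ω x) y = 3 / 2 * inner ℝ x y + k * A (j x) ω (j y) := by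
  simp [stepOperator, inner_add_left, inner_smul_left]

variable [MeasurableSpace V] {m₀ : MeasurableSpace Ω} {p κ c μ ν : ℝ} {ι : V →L[ℝ] H}
  {A : V → Ω → StrongDual ℝ V} {B : V → Ω → HilbertSchmidt E H}

theorem CoefficientConditions.measurable_A_apply (h : CoefficientConditions ι m₀ p κ c μ ν A B)
    (v : V) : Measurable fun ω => A v ω :=
  h.measurable_A.comp (measurable_const.prodMk measurable_id)

theorem CoefficientConditions.measurable_B_comp (h : CoefficientConditions ι m₀ p κ c μ ν A B)
    {m : MeasurableSpace Ω} (hm : m₀ ≤ m) {u : Ω → V} (hu : Measurable[m] u) :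
    Measurable[m] fun ω => B (u ω) ω :=
  h.measurable_B.comp
    (Measurable.prodMk hu (measurable_id'' hm))

/-- Testing a step with its own solution: the energy estimate with right-hand side `f`. -/
theorem CoefficientConditions.energy_le
    (hAB : CoefficientConditions ι m₀ p κ c μ ν A B) {k : ℝ} (hk : 0 ≤ k) (hkκ : 2 * k * κ < 1)
    {ω : Ω} {u : V} {f : H} (h : 3 / 2 * ‖ι u‖ ^ 2 + k * A u ω u = inner ℝ f (ι u)) :
    ‖ι u‖ ^ 2 + k * ‖B u ω‖ ^ 2 + k * μ * ‖u‖ ^ p ≤ ‖f‖ ^ 2 + k * c := by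
  have h1 := mul_le_mul_of_nonneg_left (hAB.coercive u ω) hk
  have h2 := real_inner_le_norm f (ι u)
  have h3 := mul_le_mul_of_nonneg_left
    (mul_le_mul_of_nonneg_right hAB.one_le_ν (sq_nonneg ‖B u ω‖)) hk
  nlinarith [sq_nonneg (‖f‖ - ‖ι u‖), mul_le_mul_of_nonneg_right hkκ.le (sq_nonneg ‖ι u‖)]

theorem exists_pos_lt_mul_rpow {k b C : ℝ} (hp : 1 < p) (hk : 0 < k) (hμ : 0 < μ)
    (hc : 0 ≤ c) :
    ∃ s, 0 < s ∧ k * c + 2 * b * (C * s) < k * μ * s ^ p := by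
  have hkμ : 0 < k * μ := mul_pos hk hμ
  obtain ⟨s, hs, hs1⟩ := (((tendsto_rpow_atTop (sub_pos.2 hp)).eventually_gt_atTop
    ((k * c + 2 * b * C) / (k * μ))).and (eventually_ge_atTop (1 : ℝ))).exists
  have hs0 : 0 < s := by linarith
  refine ⟨s, hs0, ?_⟩
  rw [div_lt_iff₀ hkμ] at hs
  have h1 : s ^ p = s ^ (p - 1) * s := by
    rw [← Real.rpow_add_one hs0.ne', sub_add_cancel]
  rw [h1]
  have h2 := mul_lt_mul_of_pos_right hs hs0
  have h3 : k * c ≤ k * c * s := le_mul_of_one_le_right (by positivity) hs1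
  nlinarith

/-- One step of the implicit scheme is solvable by a measurable function, also in the borderline
case `k κ = 3` in which the solution need not be unique. -/
theorem CoefficientConditions.exists_measurable_stepOperator_eq [OpensMeasurableSpace V]
    [MeasurableSpace K] [BorelSpace K]
    (h : CoefficientConditions ι m₀ p κ c μ ν A B) (hp : 1 < p) {k : ℝ} (hk : 0 < k)
    (hkκ : k * κ ≤ 3) {j : K →L[ℝ] V} (hj : ∀ x, ‖ι (j x)‖ = ‖x‖)
    {m : MeasurableSpace Ω} (hm : m₀ ≤ m) {b : Ω → K} (hb : Measurable[m] b) :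
    ∃ x : Ω → K, Measurable[m] x ∧ ∀ ω, stepOperator j A k ω (x ω) = b ω := by
  let G : Ω → K → K := fun ω x => stepOperator j A k ω x - b ω
  have hmono : ∀ ω x y, 0 ≤ inner ℝ (G ω x - G ω y) (x - y) := fun ω x y => by
    have h1 := h.monotone (j x) (j y) ω
    rw [← map_sub j, hj, sub_apply] at h1
    have h2 : inner ℝ (G ω x - G ω y) (x - y) =
        3 / 2 * ‖x - y‖ ^ 2 + k * (A (j x) ω (j (x - y)) - A (j y) ω (j (x - y))) := by
      simp only [G, sub_sub_sub_cancel_right]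
      rw [inner_sub_left, inner_stepOperator, inner_stepOperator, ← real_inner_self_eq_norm_sq,
        inner_sub_left x y]
      ring
    rw [h2]
    nlinarith [mul_le_mul_of_nonneg_left ((sq_nonneg _).trans h1) hk.le, sq_nonneg ‖x - y‖,
      mul_le_mul_of_nonneg_right hkκ (sq_nonneg ‖x - y‖)]
  have hhemi : ∀ ω x z w, ContinuousOn (fun r : ℝ => inner ℝ (G ω (x + r • z)) w)
      (Set.Icc 0 1) := fun ω x z w => by
    simp only [G, inner_sub_left, inner_stepOperator, map_add, map_smul]
    have := h.hemicontinuous (j x) (j z) (j w) ω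
    have h2 : ContinuousOn (fun r : ℝ => 3 / 2 * inner ℝ (x + r • z) w) (Set.Icc 0 1) := by
      fun_prop
    exact (h2.add (this.const_mul k)).sub continuousOn_const
  have hbdd : ∀ ω (r : ℝ), ∃ M : ℝ, ∀ x, ‖x‖ ≤ r → ‖G ω x‖ ≤ M := fun ω r => by
    refine ⟨3 / 2 * r + k * (c * (1 + ‖j‖ * r) ^ (p - 1) * ‖j‖) + ‖b ω‖, fun x hx => ?_⟩
    refine (norm_sub_le _ _).trans (add_le_add_left ((norm_add_le _ _).trans ?_) _)
    rw [norm_smul, norm_smul, LinearIsometryEquiv.norm_map, Real.norm_of_nonneg hk.le,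
      Real.norm_of_nonneg (by norm_num : (0 : ℝ) ≤ 3 / 2)]
    gcongr
    refine (ContinuousLinearMap.opNorm_comp_le _ _).trans ?_
    gcongr
    refine (h.growth _ _).trans ?_
    have h1 : ‖j x‖ ≤ ‖j‖ * r := (j.le_opNorm x).trans (by gcongr)
    have := h.c_nonneg
    gcongr
  have hzero : ∀ ω, ∃ x, G ω x = 0 := fun ω => by
    have hC : 0 < ‖ι‖ + 1 := by positivity
    obtain ⟨s, hs0, hs⟩ := exists_pos_lt_mul_rpow hp hk h.μ_pos h.c_nonneg (b := ‖b ω‖)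
      (C := ‖ι‖ + 1)
    refine exists_eq_zero_of_monotone (hmono ω) (hhemi ω) (mul_pos hC hs0) fun x hx => ?_
    have h1 := h.coercive (j x) ω
    rw [hj] at h1
    have h2 : s ≤ ‖j x‖ := by
      have : ‖x‖ ≤ (‖ι‖ + 1) * ‖j x‖ := by
        rw [← hj]
        refine (ι.le_opNorm _).trans ?_
        gcongr
        linarith
      rw [hx] at this
      exact le_of_mul_le_mul_left this hC
    have h3 : s ^ p ≤ ‖j x‖ ^ p := Real.rpow_le_rpow hs0.le h2 (by linarith)
    have h4 : inner ℝ (b ω) x ≤ ‖b ω‖ * ((‖ι‖ + 1) * s) := hx ▸ real_inner_le_norm _ _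
    have h5 : 0 ≤ ν * ‖B (j x) ω‖ ^ 2 :=
      mul_nonneg (zero_le_one.trans h.one_le_ν) (sq_nonneg _)
    have h6 : k * (μ * s ^ p - c) ≤ k * (2 * A (j x) ω (j x) + κ * ‖x‖ ^ 2) := by
      refine mul_le_mul_of_nonneg_left ?_ hk.le
      have := mul_le_mul_of_nonneg_left h3 h.μ_pos.le
      linarith
    simp only [G, inner_sub_left, inner_stepOperator, real_inner_self_eq_norm_sq]
    nlinarith [mul_le_mul_of_nonneg_right hkκ (sq_nonneg ‖x‖)]
  have hmeas : ∀ y, Measurable[m] fun ω => G ω y := fun y => by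
    have hcont : Continuous fun a : StrongDual ℝ V =>
        (3 / 2 : ℝ) • y + k • (InnerProductSpace.toDual ℝ K).symm (a.comp j) := by
      have : Continuous fun a : StrongDual ℝ V => a.comp j := continuous_id.clm_comp continuous_const
      exact continuous_const.add
        (((InnerProductSpace.toDual ℝ K).symm.continuous.comp this).const_smul k)
    exact (hcont.measurable.comp ((h.measurable_A_apply (j y)).mono hm le_rfl)).sub hb
  obtain ⟨x, hx, hx0⟩ := exists_measurable_eq_zero
    (fun ω => continuous_of_monotone (hmono ω) (hhemi ω) (hbdd ω)) hmeas hzero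
    (fun ω => convex_setOf_eq_zero_of_monotone (hmono ω) (hhemi ω))
  exact ⟨x, hx, fun ω => sub_eq_zero.1 (hx0 ω)⟩

end OneStep

/-! ### Solutions of the scheme -/

section Scheme

theorem memLp_two_of_sq_le {Ω : Type*} {mΩ : MeasurableSpace Ω} {P : Measure Ω}
    {γ : Type*} [NormedAddCommGroup γ] {f : Ω → γ} {q : Ω → ℝ} {a : ℝ}
    (ha : 0 < a) (hf : AEStronglyMeasurable f P) (hq : Integrable q P)
    (h : ∀ᵐ ω ∂P, a * ‖f ω‖ ^ 2 ≤ q ω) : MemLp f 2 P := by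
  refine (memLp_two_iff_integrable_sq_norm hf).2 ?_
  refine (hq.const_mul a⁻¹).mono' (hf.norm.pow 2) ?_
  filter_upwards [h] with ω hω
  rw [Real.norm_of_nonneg (sq_nonneg _), inv_mul_eq_div, le_div_iff₀ ha, mul_comm]
  exact hω

/-- Dependent choice for recursions of second order. -/
theorem exists_seq_of_forall_exists {S : ℕ → Type*} {R : ∀ n, S n → S (n + 1) → S (n + 2) → Prop}
    (h : ∀ n a b, ∃ c, R n a b c) (a : S 0) (b : S 1) :
    ∃ x : ∀ n, S n, x 0 = a ∧ x 1 = b ∧ ∀ n, R n (x n) (x (n + 1)) (x (n + 2)) := by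
  choose f hf using h
  let q : ∀ n, S n × S (n + 1) := fun n =>
    Nat.rec (motive := fun n => S n × S (n + 1)) (a, b) (fun n s => (s.2, f n s.1 s.2)) n
  exact ⟨fun n => (q n).1, rfl, rfl, fun n => hf n (q n).1 (q n).2⟩

theorem gridPoint_mono {T : ℝ} (hT : 0 < T) (N : ℕ) : Monotone (gridPoint hT N) := fun _ _ hab =>
  Set.monotone_projIcc hT.le (mul_le_mul_of_nonneg_right (Nat.cast_le.2 hab)
    (div_nonneg hT.le (Nat.cast_nonneg N)))

theorem ae_forall_mem_eq_of_forall_mem_ae_eq {V : Type*} [NormedAddCommGroup V] [NormedSpace ℝ V]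
    (W : Submodule ℝ V) [FiniteDimensional ℝ W] {Ω : Type*} {mΩ : MeasurableSpace Ω} {P : Measure Ω}
    {f g : Ω → StrongDual ℝ V} (h : ∀ v ∈ W, ∀ᵐ ω ∂P, f ω v = g ω v) :
    ∀ᵐ ω ∂P, ∀ v ∈ W, f ω v = g ω v := by
  let b := Module.finBasis ℝ W
  have hb : ∀ᵐ ω ∂P, ∀ i, f ω (b i) = g ω (b i) := ae_all_iff.2 fun i => h _ (b i).2
  filter_upwards [hb] with ω hω v hv
  have : (f ω : V →ₗ[ℝ] ℝ) ∘ₗ W.subtype = (g ω : V →ₗ[ℝ] ℝ) ∘ₗ W.subtype := b.ext hω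
  exact LinearMap.congr_fun this ⟨v, hv⟩

variable {V : Type*} [NormedAddCommGroup V] [NormedSpace ℝ V]
  {H : Type*} [NormedAddCommGroup H] [InnerProductSpace ℝ H]

/-- The inverse `ι(V_h) → V_h` of the embedding. -/
noncomputable def discreteLift {ι : V →L[ℝ] H} (hι : Function.Injective ι) (Vh : Submodule ℝ V)
    [FiniteDimensional ℝ Vh] : Vh.map (ι : V →ₗ[ℝ] H) →L[ℝ] V :=
  LinearMap.toContinuousLinearMap
    (Vh.subtype ∘ₗ (Vh.equivMapOfInjective (ι : V →ₗ[ℝ] H) hι).symm.toLinearMap)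

section Lift

variable {ι : V →L[ℝ] H} (hι : Function.Injective ι) (Vh : Submodule ℝ V) [FiniteDimensional ℝ Vh]

theorem discreteLift_mem (x : Vh.map (ι : V →ₗ[ℝ] H)) : discreteLift hι Vh x ∈ Vh := by
  simp [discreteLift]

theorem map_discreteLift (x : Vh.map (ι : V →ₗ[ℝ] H)) : ι (discreteLift hι Vh x) = x := by
  obtain ⟨y, rfl⟩ := (Vh.equivMapOfInjective (ι : V →ₗ[ℝ] H) hι).surjective x
  simp [discreteLift]

theorem discreteLift_map {v : V} (hv : v ∈ Vh) :
    discreteLift hι Vh ⟨ι v, Submodule.mem_map_of_mem hv⟩ = v :=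
  hι (map_discreteLift hι Vh _)

theorem embPreimage_coe (x : Vh.map (ι : V →ₗ[ℝ] H)) :
    embPreimage ι (x : H) = discreteLift hι Vh x := by
  rw [← map_discreteLift hι Vh x, embPreimage_apply hι]

end Lift

variable [MeasurableSpace H] {ι : V →L[ℝ] H}
  {E : Type*} [NormedAddCommGroup E] [InnerProductSpace ℝ E] [CompleteSpace E]
  {Ω : Type*} {mΩ : MeasurableSpace Ω} {P : Measure Ω}
  {T : ℝ} {hT : 0 < T} {F : Filtration (Set.Icc (0 : ℝ) T) mΩ}
  {J : Type*} {e : HilbertBasis J ℝ E} {β : J → Set.Icc (0 : ℝ) T → Ω → ℝ}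
  {p κ c μ ν : ℝ} {A : V → Ω → StrongDual ℝ V} {B : V → Ω → HilbertSchmidt E H}
  {Vh : Submodule ℝ V} [FiniteDimensional ℝ Vh] {N : ℕ} {ξ : Fin 2 → Ω → H} {X Y : ℕ → Ω → H}

/-- The defining equation of a step, with the exceptional null set independent of the test
function. -/
theorem IsBDF2Solution.exists_ae_forall (h : IsBDF2Solution P hT F e β ι A B Vh N ξ X) {n : ℕ}
    (hn : n + 2 ≤ N) : ∃ Z Z' : Ω → H,
    IsNoiseIncrement P e β (fun ω => B (embPreimage ι (X (n + 1) ω)) ω)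
      (gridPoint hT N (n + 1)) (gridPoint hT N (n + 2)) Z ∧
    IsNoiseIncrement P e β (fun ω => B (embPreimage ι (X n ω)) ω)
      (gridPoint hT N n) (gridPoint hT N (n + 1)) Z' ∧
    ∀ᵐ ω ∂P, ∀ v ∈ Vh,
      inner ℝ ((3 / 2 : ℝ) • X (n + 2) ω - (2 : ℝ) • X (n + 1) ω + (1 / 2 : ℝ) • X n ω) (ι v)
          + T / N * A (embPreimage ι (X (n + 2) ω)) ω v
        = inner ℝ ((3 / 2 : ℝ) • Z ω - (1 / 2 : ℝ) • Z' ω) (ι v) := by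
  obtain ⟨Z, Z', hZ, hZ', heq⟩ := h.step n hn
  refine ⟨Z, Z', hZ, hZ', ?_⟩
  exact ae_forall_mem_eq_of_forall_mem_ae_eq Vh
    (f := fun ω => (innerSL ℝ ((3 / 2 : ℝ) • X (n + 2) ω - (2 : ℝ) • X (n + 1) ω +
      (1 / 2 : ℝ) • X n ω)).comp ι + (T / N) • A (embPreimage ι (X (n + 2) ω)) ω)
    (g := fun ω => (innerSL ℝ ((3 / 2 : ℝ) • Z ω - (1 / 2 : ℝ) • Z' ω)).comp ι) heq

variable [MeasurableSpace V]

/-- Uniqueness: the difference `d` of two solutions, used as test function, satisfies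
`(3 - k κ) ‖d‖² ≤ 0` by monotonicity, since the two noise increments agree. -/
theorem IsBDF2Solution.ae_eq [Countable J] (hι : Function.Injective ι)
    (hAB : CoefficientConditions ι (F ⟨0, Set.left_mem_Icc.2 hT.le⟩) p κ c μ ν A B)
    (hN : 0 < N) (hk : T / N * κ < 3) (hX : IsBDF2Solution P hT F e β ι A B Vh N ξ X)
    (hY : IsBDF2Solution P hT F e β ι A B Vh N ξ Y) : ∀ n ≤ N, X n =ᵐ[P] Y n := by
  have hkpos : 0 < T / N := div_pos hT (Nat.cast_pos.2 hN)
  intro n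
  induction n using Nat.twoStepInduction with
  | zero => exact fun _ => (hX.init 0).trans (hY.init 0).symm
  | one => exact fun _ => (hX.init 1).trans (hY.init 1).symm
  | more n ih0 ih1 =>
    intro hn
    have h0 := ih0 (by omega)
    have h1 := ih1 (by omega)
    obtain ⟨Z, Z', hZ, hZ', hXeq⟩ := hX.exists_ae_forall hn
    obtain ⟨W, W', hW, hW', hYeq⟩ := hY.exists_ae_forall hn
    have hZW : Z =ᵐ[P] W := hZ.ae_eq hW (h1.mono fun ω hω => by simp only [hω])
    have hZW' : Z' =ᵐ[P] W' := hZ'.ae_eq hW' (h0.mono fun ω hω => by simp only [hω])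
    filter_upwards [h0, h1, hZW, hZW', hXeq, hYeq, hX.mem _ hn, hY.mem _ hn] with
      ω e0 e1 e2 e3 eX eY ⟨u, hu, huX⟩ ⟨v, hv, hvY⟩
    have h2 := eX (u - v) (sub_mem hu hv)
    have h3 := eY (u - v) (sub_mem hu hv)
    rw [← huX, embPreimage_apply hι] at h2
    rw [← hvY, embPreimage_apply hι, ← e0, ← e1, ← e2, ← e3, ← h2] at h3
    have h4 := (sq_nonneg _).trans (hAB.monotone u v ω)
    rw [sub_apply] at h4
    have h5 : ‖ι (u - v)‖ ^ 2 = inner ℝ (ι u) (ι (u - v)) - inner ℝ (ι v) (ι (u - v)) := by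
      rw [← inner_sub_left, ← map_sub, real_inner_self_eq_norm_sq]
    simp only [inner_add_left, inner_sub_left, inner_smul_left, conj_trivial] at h3
    have h6 : ‖ι (u - v)‖ ^ 2 * (3 - T / N * κ) ≤ 0 := by
      nlinarith [mul_nonneg hkpos.le h4]
    have h7 : ‖ι (u - v)‖ ^ 2 ≤ 0 := nonpos_of_mul_nonpos_left h6 (by linarith)
    have h8 : ι (u - v) = 0 := by
      rw [← norm_eq_zero, ← pow_eq_zero_iff two_ne_zero]
      exact le_antisymm h7 (sq_nonneg _)
    rw [← huX, ← hvY]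
    rwa [map_sub, sub_eq_zero] at h8

variable [BorelSpace H] [BorelSpace V]

/-- Almost surely `x = ι v` with `v ∈ V_h`, and there the preimage is a continuous function of `x`;
completeness of the filtration takes care of the null set. -/
theorem measurable_embPreimage (hι : Function.Injective ι)
    (hF : UsualConditions P F) {t : Set.Icc (0 : ℝ) T} {x : Ω → H} (hx : Measurable[F t] x)
    (hmem : ∀ᵐ ω ∂P, ∃ v ∈ Vh, ι v = x ω) : Measurable[F t] fun ω => embPreimage ι (x ω) := by
  let K := Vh.map (ι : V →ₗ[ℝ] H)
  have hcont : Continuous fun y : H => discreteLift hι Vh (K.orthogonalProjectionOnto y) := by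
    fun_prop
  refine hF.measurable_of_ae_eq (hcont.measurable.comp hx) ?_
  filter_upwards [hmem] with ω ⟨v, hv, hvx⟩
  have hxK : x ω = ((⟨ι v, Submodule.mem_map_of_mem hv⟩ : K) : H) := hvx.symm
  rw [Function.comp_apply, hxK, embPreimage_coe hι Vh,
    Submodule.orthogonalProjectionOnto_mem_subspace_eq_self]

variable [CompleteSpace H] [TopologicalSpace.SeparableSpace H]

/-- The scheme is solved step by step in the finite-dimensional space `K = ι(V_h)` with the inner
product of `H`; testing with `V_h` means that the explicit terms are projected onto `K`. -/
theorem exists_isBDF2Solution (hι : Function.Injective ι) (hF : UsualConditions P F)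
    [IsFiniteMeasure P] [Countable J] (hβ : IsBrownianFamily P F β)
    (hAB : CoefficientConditions ι (F ⟨0, Set.left_mem_Icc.2 hT.le⟩) p κ c μ ν A B) (hp : 1 < p)
    (hN : 0 < N) (hk : T / N * κ ≤ 3) (hξ : AdmissibleInitialValues P hT F ι B Vh N ξ) :
    ∃ X : ℕ → Ω → H, IsBDF2Solution P hT F e β ι A B Vh N ξ X := by
  let K := Vh.map (ι : V →ₗ[ℝ] H)
  let j : K →L[ℝ] V := discreteLift hι Vh
  have hjι : ∀ x : K, ι (j x) = x := map_discreteLift hι Vh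
  have hF0 : ∀ t, F ⟨0, Set.left_mem_Icc.2 hT.le⟩ ≤ F t := fun t => F.mono t.2.1
  have hkpos : 0 < T / N := div_pos hT (Nat.cast_pos.2 hN)
  let S : ℕ → Type _ := fun n => {x : Ω → K // Measurable[F (gridPoint hT N n)] x}
  have hB : ∀ (n : ℕ) (x : S n), Measurable[F (gridPoint hT N n)]
      fun ω => B (embPreimage ι (x.1 ω : H)) ω := fun n x => by
    simp only [embPreimage_coe hι Vh]
    exact hAB.measurable_B_comp (hF0 _) (j.continuous.measurable.comp x.2)
  have hstep : ∀ (n : ℕ) (x : S n) (x' : S (n + 1)), ∃ x'' : S (n + 2), ∃ Z Z' : Ω → H,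
      IsNoiseIncrement P e β (fun ω => B (embPreimage ι (x'.1 ω : H)) ω)
        (gridPoint hT N (n + 1)) (gridPoint hT N (n + 2)) Z ∧
      IsNoiseIncrement P e β (fun ω => B (embPreimage ι (x.1 ω : H)) ω)
        (gridPoint hT N n) (gridPoint hT N (n + 1)) Z' ∧
      ∀ v ∈ Vh, ∀ ω,
        inner ℝ ((3 / 2 : ℝ) • (x''.1 ω : H) - (2 : ℝ) • (x'.1 ω : H) + (1 / 2 : ℝ) • (x.1 ω : H))
          (ι v) + T / N * A (embPreimage ι (x''.1 ω : H)) ω v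
        = inner ℝ ((3 / 2 : ℝ) • Z ω - (1 / 2 : ℝ) • Z' ω) (ι v) := fun n x x' => by
    have h01 := gridPoint_mono hT N (Nat.le_succ n)
    have h12 := gridPoint_mono hT N (Nat.le_succ (n + 1))
    obtain ⟨Z, hZm, hZ⟩ := hβ.exists_isNoiseIncrement hF e h12 (hB (n + 1) x')
    obtain ⟨Z', hZm', hZ'⟩ := hβ.exists_isNoiseIncrement hF e h01 (hB n x)
    let r : Ω → H := fun ω => ((3 / 2 : ℝ) • Z ω - (1 / 2 : ℝ) • Z' ω) +
      ((2 : ℝ) • (x'.1 ω : H) - (1 / 2 : ℝ) • (x.1 ω : H))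
    have hr : Measurable[F (gridPoint hT N (n + 2))] r :=
      ((hZm.const_smul _).sub ((hZm'.mono (F.mono h12) le_rfl).const_smul _)).add
        (((measurable_subtype_coe.comp (x'.2.mono (F.mono h12) le_rfl)).const_smul _).sub
          ((measurable_subtype_coe.comp (x.2.mono (F.mono (h01.trans h12)) le_rfl)).const_smul _))
    obtain ⟨x'', hx'', heq⟩ := hAB.exists_measurable_stepOperator_eq hp hkpos hk
      (j := j) (fun x => by rw [hjι]; rfl) (hF0 (gridPoint hT N (n + 2)))
      (b := fun ω => K.orthogonalProjectionOnto (r ω))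
      (K.orthogonalProjectionOnto.continuous.measurable.comp hr)
    refine ⟨⟨x'', hx''⟩, Z, Z', hZ, hZ', fun v hv ω => ?_⟩
    have h1 := congrArg (fun y => inner ℝ y (⟨ι v, Submodule.mem_map_of_mem hv⟩ : K)) (heq ω)
    simp only [inner_stepOperator] at h1
    rw [show j ⟨ι v, Submodule.mem_map_of_mem hv⟩ = v from discreteLift_map hι Vh hv,
      Submodule.inner_orthogonalProjectionOnto_eq_of_mem_right, Submodule.coe_inner] at h1
    simp only [r, inner_add_left, inner_sub_left, inner_smul_left, conj_trivial] at h1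
    rw [embPreimage_coe hι Vh]
    simp only [inner_add_left, inner_sub_left, inner_smul_left, conj_trivial]
    change _ + T / N * A (j (x'' ω)) ω v = _
    linarith
  have hinit : ∀ n : Fin 2, Measurable[F (gridPoint hT N n)]
      fun ω => K.orthogonalProjectionOnto (ξ n ω) := fun n =>
    K.orthogonalProjectionOnto.continuous.measurable.comp (hξ.measurable n)
  obtain ⟨x, hx0, hx1, hx⟩ := exists_seq_of_forall_exists (S := S) hstep
    ⟨fun ω => K.orthogonalProjectionOnto (ξ 0 ω), hinit 0⟩
    ⟨fun ω => K.orthogonalProjectionOnto (ξ 1 ω), hinit 1⟩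
  have hproj : ∀ n, (fun ω => (K.orthogonalProjectionOnto (ξ n ω) : H)) =ᵐ[P] ξ n := fun n => by
    filter_upwards [hξ.mem n] with ω ⟨v, hv, hvx⟩
    rw [← hvx]
    exact congrArg Subtype.val (Submodule.orthogonalProjectionOnto_mem_subspace_eq_self
      (⟨ι v, Submodule.mem_map_of_mem hv⟩ : K))
  refine ⟨fun n ω => ((x n).1 ω : H), ⟨fun n _ => measurable_subtype_coe.comp (x n).2,
    fun n _ => ae_of_all _ fun ω => ?_, fun n => ?_, fun n _ => ?_⟩⟩
  · exact ⟨j ((x n).1 ω), discreteLift_mem hι Vh _, hjι _⟩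
  · fin_cases n
    · simpa [hx0] using hproj 0
    · simpa [hx1] using hproj 1
  · obtain ⟨Z, Z', hZ, hZ', heq⟩ := hx n
    exact ⟨Z, Z', hZ, hZ', fun v hv => ae_of_all _ (heq v hv)⟩

/-- Square integrability of `Xⁿ` and of `B(Xⁿ)` propagates together: both are needed for the noise
increments of the next steps to be square integrable. -/
theorem IsBDF2Solution.memLp [TopologicalSpace.SeparableSpace V] [IsFiniteMeasure P] [Countable J]
    (hι : Function.Injective ι) (hF : UsualConditions P F) (hβ : IsBrownianFamily P F β)
    (hAB : CoefficientConditions ι (F ⟨0, Set.left_mem_Icc.2 hT.le⟩) p κ c μ ν A B) (hp : 1 < p)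
    (hN : 0 < N) (hk : 2 * (T / N) * κ < 1) (hξ : AdmissibleInitialValues P hT F ι B Vh N ξ)
    (hX : IsBDF2Solution P hT F e β ι A B Vh N ξ X) {n : ℕ} (hn2 : 2 ≤ n) (hn : n ≤ N) :
    MemLp (fun ω => embPreimage ι (X n ω)) (ENNReal.ofReal p) P ∧ MemLp (X n) 2 P := by
  have hkpos : 0 < T / N := div_pos hT (Nat.cast_pos.2 hN)
  have hF0 : ∀ t, F ⟨0, Set.left_mem_Icc.2 hT.le⟩ ≤ F t := fun t => F.mono t.2.1
  have hu : ∀ n ≤ N, Measurable[F (gridPoint hT N n)] fun ω => embPreimage ι (X n ω) := fun n hn =>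
    measurable_embPreimage hι hF (hX.adapted n hn) (hX.mem n hn)
  have hB : ∀ n ≤ N, Measurable[F (gridPoint hT N n)] fun ω => B (embPreimage ι (X n ω)) ω :=
    fun n hn => hAB.measurable_B_comp (hF0 _) (hu n hn)
  have hstep : ∀ n, n + 2 ≤ N → MemLp (X n) 2 P → MemLp (X (n + 1)) 2 P →
      MemLp (fun ω => ‖B (embPreimage ι (X n ω)) ω‖) 2 P →
      MemLp (fun ω => ‖B (embPreimage ι (X (n + 1) ω)) ω‖) 2 P →
      ∃ q : Ω → ℝ, Integrable q P ∧ ∀ᵐ ω ∂P, ‖X (n + 2) ω‖ ^ 2 +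
        T / N * ‖B (embPreimage ι (X (n + 2) ω)) ω‖ ^ 2 +
        T / N * μ * ‖embPreimage ι (X (n + 2) ω)‖ ^ p ≤ q ω := by
    intro n hn hX0 hX1 hB0 hB1
    obtain ⟨Z, Z', hZ, hZ', heq⟩ := hX.exists_ae_forall hn
    obtain ⟨W, hW2, hW⟩ := hβ.exists_isNoiseIncrement_memLp e
      (gridPoint_mono hT N (Nat.le_succ (n + 1))) (hB (n + 1) (by omega)) hB1
    obtain ⟨W', hW2', hW'⟩ := hβ.exists_isNoiseIncrement_memLp e
      (gridPoint_mono hT N (Nat.le_succ n)) (hB n (by omega)) hB0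
    have hZ2 : MemLp Z 2 P := (memLp_congr_ae (hZ.ae_eq hW (ae_eq_refl _))).2 hW2
    have hZ2' : MemLp Z' 2 P := (memLp_congr_ae (hZ'.ae_eq hW' (ae_eq_refl _))).2 hW2'
    have hf : MemLp (fun ω => ((3 / 2 : ℝ) • Z ω - (1 / 2 : ℝ) • Z' ω) +
        ((2 : ℝ) • X (n + 1) ω - (1 / 2 : ℝ) • X n ω)) 2 P :=
      ((hZ2.const_smul _).sub (hZ2'.const_smul _)).add ((hX1.const_smul _).sub (hX0.const_smul _))
    refine ⟨_, ((memLp_two_iff_integrable_sq_norm hf.1).1 hf).add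
      (integrable_const (T / N * c)), ?_⟩
    filter_upwards [heq, hX.mem _ hn] with ω h ⟨u, hu, huX⟩
    have h1 := h u hu
    rw [← huX, embPreimage_apply hι] at h1 ⊢
    refine hAB.energy_le hkpos.le hk ?_
    rw [← real_inner_self_eq_norm_sq]
    simp only [inner_add_left, inner_sub_left, inner_smul_left, conj_trivial] at h1 ⊢
    linarith
  have hsm : ∀ n ≤ N, AEStronglyMeasurable (X n) P := fun n hn =>
    ((hX.adapted n hn).mono (F.le _) le_rfl).aestronglyMeasurable
  have hBsm : ∀ n ≤ N, AEStronglyMeasurable (fun ω => ‖B (embPreimage ι (X n ω)) ω‖) P :=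
    fun n hn => (measurable_norm.comp ((hB n hn).mono (F.le _) le_rfl)).aestronglyMeasurable
  have hinit : ∀ n : Fin 2, MemLp (X n) 2 P ∧
      MemLp (fun ω => ‖B (embPreimage ι (X n ω)) ω‖) 2 P := fun n => by
    refine ⟨(memLp_congr_ae (hX.init n)).2 (hξ.memLp n), ?_⟩
    refine (memLp_congr_ae ?_).2 (hξ.memLp_B n).norm
    filter_upwards [hX.init n] with ω hω
    rw [hω]
  have hmem : ∀ n ≤ N, MemLp (X n) 2 P ∧ MemLp (fun ω => ‖B (embPreimage ι (X n ω)) ω‖) 2 P := by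
    intro n
    induction n using Nat.twoStepInduction with
    | zero => exact fun _ => hinit 0
    | one => exact fun _ => hinit 1
    | more n ih0 ih1 =>
      intro hn
      obtain ⟨hX0, hB0⟩ := ih0 (by omega)
      obtain ⟨hX1, hB1⟩ := ih1 (by omega)
      obtain ⟨q, hq, hle⟩ := hstep n hn hX0 hX1 hB0 hB1
      have hnn : ∀ ω, 0 ≤ T / N * μ * ‖embPreimage ι (X (n + 2) ω)‖ ^ p := fun ω =>
        mul_nonneg (mul_pos hkpos hAB.μ_pos).le (Real.rpow_nonneg (norm_nonneg _) _)
      refine ⟨memLp_two_of_sq_le one_pos (hsm _ hn) hq ?_,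
        memLp_two_of_sq_le hkpos (hBsm _ hn) hq ?_⟩
      · filter_upwards [hle] with ω hω
        have := mul_nonneg hkpos.le (sq_nonneg ‖B (embPreimage ι (X (n + 2) ω)) ω‖)
        linarith [hnn ω]
      · filter_upwards [hle] with ω hω
        rw [norm_norm]
        linarith [hnn ω, sq_nonneg ‖X (n + 2) ω‖]
  refine ⟨?_, (hmem n hn).1⟩
  obtain ⟨n, rfl⟩ := Nat.exists_eq_add_of_le' hn2
  obtain ⟨hX0, hB0⟩ := hmem n (by omega)
  obtain ⟨hX1, hB1⟩ := hmem (n + 1) (by omega)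
  obtain ⟨q, hq, hle⟩ := hstep n hn hX0 hX1 hB0 hB1
  have husm : AEStronglyMeasurable (fun ω => embPreimage ι (X (n + 2) ω)) P :=
    ((hu _ hn).mono (F.le _) le_rfl).aestronglyMeasurable
  have hp0 : 0 < p := by linarith
  have hμ : 0 < T / N * μ := mul_pos hkpos hAB.μ_pos
  refine (integrable_norm_rpow_iff husm (ENNReal.ofReal_pos.2 hp0).ne' ENNReal.ofReal_ne_top).1 ?_
  rw [ENNReal.toReal_ofReal hp0.le]
  refine (hq.const_mul (T / N * μ)⁻¹).mono'
    (husm.norm.aemeasurable.pow_const p).aestronglyMeasurable ?_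
  filter_upwards [hle] with ω hω
  rw [Real.norm_of_nonneg (Real.rpow_nonneg (norm_nonneg _) _), inv_mul_eq_div, le_div_iff₀ hμ,
    mul_comm]
  have := mul_nonneg hkpos.le (sq_nonneg ‖B (embPreimage ι (X (n + 2) ω)) ω‖)
  linarith [sq_nonneg ‖X (n + 2) ω‖]

end Scheme

theorem theorem3p3
    {V : Type*} [NormedAddCommGroup V] [NormedSpace ℝ V] [CompleteSpace V]
    [TopologicalSpace.SeparableSpace V] [MeasurableSpace V] [BorelSpace V]
    {H : Type*} [NormedAddCommGroup H] [InnerProductSpace ℝ H] [CompleteSpace H]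
    [TopologicalSpace.SeparableSpace H] [MeasurableSpace H] [BorelSpace H]
    (ι : V →L[ℝ] H) (hι : IsGelfandTriple ι)
    {U : Type*} [NormedAddCommGroup U] [InnerProductSpace ℝ U] [CompleteSpace U]
    [TopologicalSpace.SeparableSpace U]
    (Q R : U →L[ℝ] U) (hQ : Q.IsPositive) (hR : IsOperatorSqrt R Q)
    {Ω : Type*} {mΩ : MeasurableSpace Ω} (P : Measure Ω) [IsProbabilityMeasure P]
    {T : ℝ} (hT : 0 < T) (F : Filtration (Set.Icc (0 : ℝ) T) mΩ) (hF : UsualConditions P F)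
    {J : Type*} (e : HilbertBasis J ℝ (CameronMartin R))
    (β : J → Set.Icc (0 : ℝ) T → Ω → ℝ) (hβ : IsBrownianFamily P F β)
    (p κ c μ ν : ℝ) (hp : 1 < p)
    (A : V → Ω → StrongDual ℝ V) (B : V → Ω → HilbertSchmidt (CameronMartin R) H)
    (hAB : CoefficientConditions ι (F ⟨0, Set.left_mem_Icc.2 hT.le⟩) p κ c μ ν A B)
    (Vh : Submodule ℝ V) [FiniteDimensional ℝ Vh]
    (N : ℕ) (hN : 0 < N) (hk : T / N * κ ≤ 3)
    (ξ : Fin 2 → Ω → H) (hξ : AdmissibleInitialValues P hT F ι B Vh N ξ) :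
    (∃ X : ℕ → Ω → H, IsBDF2Solution P hT F e β ι A B Vh N ξ X) ∧
    (T / N * κ < 3 → ∀ X Y : ℕ → Ω → H,
      IsBDF2Solution P hT F e β ι A B Vh N ξ X → IsBDF2Solution P hT F e β ι A B Vh N ξ Y →
      ∀ᵐ ω ∂P, ∀ n ≤ N, X n ω = Y n ω) ∧
    (2 * (T / N) * κ < 1 → ∀ X : ℕ → Ω → H,
      IsBDF2Solution P hT F e β ι A B Vh N ξ X → ∀ n, 2 ≤ n → n ≤ N →
      MemLp (fun ω => embPreimage ι (X n ω)) (ENNReal.ofReal p) P ∧ MemLp (X n) 2 P) := by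
  have : Countable J := e.countable
  exact ⟨exists_isBDF2Solution hι.injective hF hβ hAB hp hN hk hξ,
    fun hk' X Y hX hY => ae_all_iff.2 fun n => (em (n ≤ N)).elim
      (fun hn => (hX.ae_eq hι.injective hAB hN hk' hY n hn).mono fun _ h _ => h)
      fun hn => ae_of_all _ fun _ h => absurd h hn,
    fun hk' _ hX _ hn2 hn => hX.memLp hι.injective hF hβ hAB hp hN hk' hξ hn2 hn⟩
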